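/- Let $n\in\mathbb N$ and $K=\mathbb Q(q)$. Let $O_q(M(n))$ be the associative unital $K$-algebra generated by $Z_{ij}$ ($1\le i,j\le n$) with the relations $$Z_{ij}Z_{ik}=q^2Z_{ik}Z_{ij}\ (j<k),\qquad Z_{ij}Z_{kj}=q^2Z_{kj}Z_{ij}\ (i<k),$$ $$Z_{ij}Z_{st}=Z_{st}Z_{ij}\ (i>s,\ j<t),\qquad Z_{ij}Z_{st}=Z_{st}Z_{ij}+(q^2-q^{-2})Z_{it}Z_{sj}\ (i<s,\ j<t).$$ Let $\overline{\phantom{x}}$ be the ring anti-automorphism of $O_q(M(n))$ with $\overline{Z_{ij}}=Z_{ij}$ and $\overline{q}=q^{-1}$. For $A=(a_{ij})\in M_n(\mathbb Z_+)$, where $\mathbb Z_+=\{0,1,2,\dots\}$, let $Z^A=\prod Z_{ij}^{a_{ij}}$ with the factors in lexicographic order of $(i,j)$, and put $$Z(A)=q^{-\sum_i\sum_{j>k}a_{ij}a_{ik}-\sum_i\sum_{j>k}a_{ji}a_{ki}}\,Z^A .$$ For each $A\in M_n(\mathbb Z_+)$ there is exactly one element $b(A)\in O_q(M(n))$ such that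 $\overline{b(A)}=b(A)$ and $$b(A)=Z(A)+\sum_{B<A}h_B(A)\,Z(B),\qquad h_B(A)\in q\mathbb Z[q],$$ a finite sum over matrices $B\in M_n(\mathbb Z_+)$ that are smaller than $A$ in the lexicographic order (positions read in lexicographic order) and have the same row sums and the same column sums as $A$. For $x,y\in O_q(M(n))$ write $x\sim y$ if $y=q^mx$ for some $m\in\mathbb Z$. Let $\xi$ be a broken line dividing the matrix: a polygonal path in the plane with coordinates $(x,y)=(\text{row},\text{column})$, running from the top or right side of the square $[1,n]^2$ (or beyond it) to its bottom or left side (or beyond it), with $x$ weakly increasing and $y$ weakly decreasing along the path, each of whose edges lies on a line $ax+by=m$ with $a,b,m\in\mathbb Z_+$ and $(a,b)\neq(0,0)$. A position $(i,j)$ is on $\xi$ or on its right lower side if there is a point $(x,y)$ of $\xi$ with $x\le i$ and $y\le j$; otherwise it is in the left upper side of $\xi$. **Theorem 4.2.** Let $A\in M_n(\mathbb Z_+)$ and write $A=A^++A^-$, where $A^+$ is obtained from $A$ by replacing the entries in the left upper side of $\xi$ by zero, and $A^-$ by replacing the entries on $\xi$ or in its right lower side by zero. Then $$b(A)\sim b(A^+)\,b(A^-)\quad\Longleftrightarrow\quad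 b(A^+)\,b(A^-)\sim b(A^-)\,b(A^+).$$ -/

import Mathlib

open scoped Polynomial

noncomputable section

namespace QMat

/-! ### The base field `ℚ(q)` and the automorphism `q ↦ q⁻¹` -/

/-- The base field `K = ℚ(q)`. -/
abbrev K : Type := RatFunc ℚ

/-- The indeterminate `q`. -/
def q : K := RatFunc.X

theorem q_ne_zero : q ≠ 0 := RatFunc.X_ne_zero

theorem aeval_inv_q_injective :
    Function.Injective (Polynomial.aeval (q⁻¹) : ℚ[X] →ₐ[ℚ] K) := by
  refine transcendental_iff_injective.mp ?_
  intro h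
  have h2 : IsAlgebraic ℚ ((q⁻¹)⁻¹ : K) := h.inv
  rw [inv_inv] at h2
  refine RatFunc.transcendental_X (K := ℚ) ?_
  have e : RatFunc.instAlgebraOfPolynomial ℚ ℚ = DivisionRing.toRatAlgebra :=
    Subsingleton.elim _ _
  rw [e]
  exact h2

/-- The field endomorphism of `ℚ(q)` (over `ℚ`) with `q ↦ q⁻¹`. -/
def barK : K →+* K :=
  RatFunc.liftRingHom (Polynomial.aeval (q⁻¹) : ℚ[X] →ₐ[ℚ] K).toRingHom
    (nonZeroDivisors_le_comap_nonZeroDivisors_of_injective _ aeval_inv_q_injective)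

theorem barK_q : barK q = q⁻¹ := by
  have h := RatFunc.liftRingHom_apply_div
    (Polynomial.aeval (q⁻¹) : ℚ[X] →ₐ[ℚ] K).toRingHom
    (nonZeroDivisors_le_comap_nonZeroDivisors_of_injective _ aeval_inv_q_injective)
    Polynomial.X 1
  simp only [AlgHom.toRingHom_eq_coe, RatFunc.algebraMap_X, map_one, div_one] at h
  exact h.trans (Polynomial.aeval_X _)

/-! ### The algebra `O_q(M(n))` -/

/-- The free generator at position `(i, j)`. -/
abbrev gen {n : ℕ} (i j : Fin n) : FreeAlgebra K (Fin n × Fin n) := FreeAlgebra.ι K (i, j)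

/-- The defining relations of the quantum matrix algebra. -/
inductive Rel (n : ℕ) :
    FreeAlgebra K (Fin n × Fin n) → FreeAlgebra K (Fin n × Fin n) → Prop
  | row (i j k : Fin n) (h : j < k) :
      Rel n (gen i j * gen i k) (q ^ 2 • (gen i k * gen i j))
  | col (i k j : Fin n) (h : i < k) :
      Rel n (gen i j * gen k j) (q ^ 2 • (gen k j * gen i j))
  | comm (i j s t : Fin n) (h₁ : s < i) (h₂ : j < t) :
      Rel n (gen i j * gen s t) (gen s t * gen i j)
  | cross (i j s t : Fin n) (h₁ : i < s) (h₂ : j < t) :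
      Rel n (gen i j * gen s t)
        (gen s t * gen i j + (q ^ 2 - (q ^ 2)⁻¹) • (gen i t * gen s j))

/-- The coordinate algebra `O_q(M(n))` of quantum `n × n` matrices. -/
abbrev Oq (n : ℕ) : Type := RingQuot (Rel n)

/-- The generator `Z_{ij}` of `O_q(M(n))`. -/
def Zgen {n : ℕ} (i j : Fin n) : Oq n := RingQuot.mkAlgHom K (Rel n) (gen i j)

theorem Zgen_row {n : ℕ} (i j k : Fin n) (h : j < k) :
    (Zgen i j * Zgen i k : Oq n) = q ^ 2 • (Zgen i k * Zgen i j) := by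
  have := RingQuot.mkAlgHom_rel K (Rel.row i j k h)
  simpa only [map_mul, map_smul, Zgen] using this

theorem Zgen_col {n : ℕ} (i k j : Fin n) (h : i < k) :
    (Zgen i j * Zgen k j : Oq n) = q ^ 2 • (Zgen k j * Zgen i j) := by
  have := RingQuot.mkAlgHom_rel K (Rel.col i k j h)
  simpa only [map_mul, map_smul, Zgen] using this

theorem Zgen_comm {n : ℕ} (i j s t : Fin n) (h₁ : s < i) (h₂ : j < t) :
    (Zgen i j * Zgen s t : Oq n) = Zgen s t * Zgen i j := by
  have := RingQuot.mkAlgHom_rel K (Rel.comm i j s t h₁ h₂)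
  simpa only [map_mul, map_smul, Zgen] using this

theorem Zgen_cross {n : ℕ} (i j s t : Fin n) (h₁ : i < s) (h₂ : j < t) :
    (Zgen i j * Zgen s t : Oq n) =
      Zgen s t * Zgen i j + (q ^ 2 - (q ^ 2)⁻¹) • (Zgen i t * Zgen s j) := by
  have := RingQuot.mkAlgHom_rel K (Rel.cross i j s t h₁ h₂)
  simpa only [map_mul, map_smul, map_add, Zgen] using this

/-! ### The bar anti-automorphism -/

/-- The ring homomorphism from a free `K`-algebra to `T` given by `f` on scalars and by `g` on the
free generators. -/
def freeLift {X T : Type} [Ring T] (f : K →+* T) (hf : ∀ c x, f c * x = x * f c) (g : X → T) :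
    FreeAlgebra K X →+* T :=
  letI : Algebra K T := f.toAlgebra' hf
  (FreeAlgebra.lift K g).toRingHom

theorem freeLift_ι {X T : Type} [Ring T] (f : K →+* T) (hf : ∀ c x, f c * x = x * f c)
    (g : X → T) (x : X) : freeLift f hf g (FreeAlgebra.ι K x) = g x := by
  let _ : Algebra K T := f.toAlgebra' hf
  exact FreeAlgebra.lift_ι_apply g x

theorem freeLift_algebraMap {X T : Type} [Ring T] (f : K →+* T)
    (hf : ∀ c x, f c * x = x * f c) (g : X → T) (c : K) :
    freeLift f hf g (algebraMap K _ c) = f c := by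
  let _ : Algebra K T := f.toAlgebra' hf
  exact (FreeAlgebra.lift K g).commutes c

/-- The ring homomorphism from the free algebra underlying `bar`: `q ↦ q⁻¹`, `Z_{ij} ↦ Z_{ij}`. -/
def barFree (n : ℕ) : FreeAlgebra K (Fin n × Fin n) →+* (Oq n)ᵐᵒᵖ :=
  freeLift ((algebraMap K (Oq n)ᵐᵒᵖ).comp barK) (fun c x => Algebra.commutes (barK c) x)
    fun p => MulOpposite.op (Zgen p.1 p.2)

theorem barFree_gen {n : ℕ} (i j : Fin n) :
    barFree n (gen i j) = MulOpposite.op (Zgen i j) :=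
  freeLift_ι _ _ _ _

theorem barFree_algebraMap {n : ℕ} (c : K) :
    barFree n (algebraMap K _ c) = MulOpposite.op (algebraMap K (Oq n) (barK c)) :=
  freeLift_algebraMap _ _ _ _

theorem barFree_smul {n : ℕ} (c : K) (x : FreeAlgebra K (Fin n × Fin n)) :
    barFree n (c • x) = barK c • barFree n x := by
  rw [Algebra.smul_def, map_mul, barFree_algebraMap, Algebra.smul_def]
  rfl

theorem barFree_rel {n : ℕ} ⦃x y : FreeAlgebra K (Fin n × Fin n)⦄ (h : Rel n x y) :
    barFree n x = barFree n y := by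
  have hq := q_ne_zero
  induction h with
  | row i j k h =>
    simp only [barFree_smul, map_mul, map_pow, barFree_gen, barK_q, ← MulOpposite.op_mul,
      ← MulOpposite.op_smul]
    rw [Zgen_row i j k h, smul_smul, ← mul_pow, inv_mul_cancel₀ hq, one_pow, one_smul]
  | col i k j h =>
    simp only [barFree_smul, map_mul, map_pow, barFree_gen, barK_q, ← MulOpposite.op_mul,
      ← MulOpposite.op_smul]
    rw [Zgen_col i k j h, smul_smul, ← mul_pow, inv_mul_cancel₀ hq, one_pow, one_smul]
  | comm i j s t h₁ h₂ =>
    simp only [map_mul, barFree_gen, ← MulOpposite.op_mul]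
    rw [Zgen_comm i j s t h₁ h₂]
  | cross i j s t h₁ h₂ =>
    simp only [barFree_smul, map_mul, map_pow, map_add, map_sub, map_inv₀, barFree_gen, barK_q,
      ← MulOpposite.op_mul, ← MulOpposite.op_smul, ← MulOpposite.op_add]
    rw [Zgen_cross i j s t h₁ h₂, Zgen_comm s j i t h₁ h₂, add_assoc, ← add_smul]
    simp

/-- `bar` as a ring homomorphism into the opposite ring. -/
def barHom (n : ℕ) : Oq n →+* (Oq n)ᵐᵒᵖ := RingQuot.lift ⟨barFree n, barFree_rel⟩

/-- The bar anti-automorphism of `O_q(M(n))` over `ℚ`: `Z_{ij} ↦ Z_{ij}`, `q ↦ q⁻¹`. -/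
def bar {n : ℕ} (x : Oq n) : Oq n := (barHom n x).unop

theorem barHom_mk {n : ℕ} (x : FreeAlgebra K (Fin n × Fin n)) :
    barHom n (RingQuot.mkAlgHom K (Rel n) x) = barFree n x := by
  have h := RingQuot.lift_mkRingHom_apply (barFree n) barFree_rel x
  rw [← RingQuot.mkAlgHom_coe K (Rel n)] at h
  exact h

theorem bar_Zgen {n : ℕ} (i j : Fin n) : bar (Zgen i j : Oq n) = Zgen i j := by
  rw [bar, Zgen, barHom_mk, barFree_gen]; rfl

theorem bar_mul {n : ℕ} (x y : Oq n) : bar (x * y) = bar y * bar x := by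
  simp [bar]

theorem bar_add {n : ℕ} (x y : Oq n) : bar (x + y) = bar x + bar y := by
  simp [bar]

theorem bar_smul {n : ℕ} (c : K) (x : Oq n) : bar (c • x) = barK c • bar x := by
  have h : barHom n (algebraMap K _ c) = MulOpposite.op (algebraMap K (Oq n) (barK c)) := by
    rw [← barFree_algebraMap, ← barHom_mk, AlgHom.commutes]
  rw [Algebra.smul_def, bar_mul, Algebra.smul_def, Algebra.commutes]
  congr 1
  rw [bar, h]; rfl

/-! ### The monomials and the dual canonical basis -/

/-- `Z^A = ∏ Z_{ij}^{a_{ij}}`, the factors in the lexicographic order of the positions. -/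
def Zpow {n : ℕ} (A : Matrix (Fin n) (Fin n) ℕ) : Oq n :=
  (List.ofFn fun i => (List.ofFn fun j => Zgen i j ^ A i j).prod).prod

/-- `∑_i ∑_{j>k} a_{ij} a_{ik} + ∑_i ∑_{j>k} a_{ji} a_{ki}`. -/
def dexp {n : ℕ} (A : Matrix (Fin n) (Fin n) ℕ) : ℕ :=
  (∑ i, ∑ j, ∑ k ∈ Finset.univ.filter (fun k => k < j), A i j * A i k) +
    ∑ i, ∑ j, ∑ k ∈ Finset.univ.filter (fun k => k < j), A j i * A k i

/-- The normalized monomial `Z(A) = D(A) Z^A`, where `D(A) = q^{-dexp A}`. -/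
def Znorm {n : ℕ} (A : Matrix (Fin n) (Fin n) ℕ) : Oq n :=
  q ^ (-(dexp A : ℤ)) • Zpow A

/-- The row sums of `A`. -/
def ro {n : ℕ} (A : Matrix (Fin n) (Fin n) ℕ) : Fin n → ℕ := fun i => ∑ j, A i j

/-- The column sums of `A`. -/
def co {n : ℕ} (A : Matrix (Fin n) (Fin n) ℕ) : Fin n → ℕ := fun j => ∑ i, A i j

/-- Strict lexicographic order of matrices, the positions being read in lexicographic order:
at the first position where they differ, `B` has the smaller entry. -/
def LexLT {n : ℕ} (B A : Matrix (Fin n) (Fin n) ℕ) : Prop :=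
  ∃ i j, (∀ s t, s < i ∨ (s = i ∧ t < j) → B s t = A s t) ∧ B i j < A i j

/-- `x` is bar-invariant and `x = Z(A) + ∑_{B < A} h_B Z(B)` (a finite sum) with
`h_B ∈ q ℤ[q]`, `ro B = ro A` and `co B = co A`. -/
def IsDualCanonical {n : ℕ} (A : Matrix (Fin n) (Fin n) ℕ) (x : Oq n) : Prop :=
  bar x = x ∧
    ∃ h : Matrix (Fin n) (Fin n) ℕ →₀ ℤ[X],
      (∀ B ∈ h.support, LexLT B A ∧ ro B = ro A ∧ co B = co A ∧ Polynomial.X ∣ h B) ∧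
      x = Znorm A + h.sum fun B p => (Polynomial.eval₂ (Int.castRingHom K) q p) • Znorm B

/-- The element `b(A)` of the dual canonical basis. -/
def b {n : ℕ} (A : Matrix (Fin n) (Fin n) ℕ) : Oq n :=
  Classical.epsilon (IsDualCanonical A)

/-- `x ∼ y`: `y = q^m x` for some integer `m`. -/
def Equivalent {n : ℕ} (x y : Oq n) : Prop := ∃ m : ℤ, y = q ^ m • x

/-- `x` and `y` are `q`-commuting: `x y ∼ y x`. -/
def QCommuting {n : ℕ} (x y : Oq n) : Prop := Equivalent (x * y) (y * x)

/-! ### Broken lines -/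

/-- The position `(i, j)`, as the point of the plane with coordinates
(row number, column number), both counted from `1`. -/
def pt {n : ℕ} (i j : Fin n) : ℝ × ℝ := (((i : ℕ) : ℝ) + 1, ((j : ℕ) : ℝ) + 1)

/-- A broken line dividing the `n × n` matrix: a polygonal path running from the top or right side
of the square `[1, n]²` (first coordinate: row, pointing down; second: column, pointing right) to
its left or bottom side, in the direction of weakly growing row and weakly decreasing column
coordinate, each of whose edges lies on a line `a x + b y = m` with nonnegative integers `a, b, m`,
`a` and `b` not both zero. -/
structure BrokenLine (n : ℕ) where
  /-- the number of edges -/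
  k : ℕ
  pos : 0 < k
  /-- the vertices, in the order of the path -/
  vertex : Fin (k + 1) → ℝ × ℝ
  on_line : ∀ e : Fin k, ∃ a b m : ℕ, (a ≠ 0 ∨ b ≠ 0) ∧
    a * (vertex e.castSucc).1 + b * (vertex e.castSucc).2 = m ∧
    a * (vertex e.succ).1 + b * (vertex e.succ).2 = m
  row_le : ∀ e : Fin k, (vertex e.castSucc).1 ≤ (vertex e.succ).1
  col_le : ∀ e : Fin k, (vertex e.succ).2 ≤ (vertex e.castSucc).2
  start_mem : (vertex 0).1 ≤ 1 ∨ (n : ℝ) ≤ (vertex 0).2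
  end_mem : (n : ℝ) ≤ (vertex (Fin.last k)).1 ∨ (vertex (Fin.last k)).2 ≤ 1

namespace BrokenLine

variable {n : ℕ}

/-- The points of the broken line. -/
def carrier (ξ : BrokenLine n) : Set (ℝ × ℝ) :=
  ⋃ e : Fin ξ.k, segment ℝ (ξ.vertex e.castSucc) (ξ.vertex e.succ)

/-- `p` is on the broken line or on its right lower side: `p` is reached from a point of the line
by moving down and to the right (possibly not at all). -/
def RightLower (ξ : BrokenLine n) (p : ℝ × ℝ) : Prop :=
  ∃ s ∈ ξ.carrier, s.1 ≤ p.1 ∧ s.2 ≤ p.2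

/-- `p` is strictly on the left upper side of the broken line. -/
def LeftUpper (ξ : BrokenLine n) (p : ℝ × ℝ) : Prop := ¬ ξ.RightLower p

open Classical in
/-- `A⁺`: the entries of `A` in the left upper side of the broken line are replaced by zero. -/
def plusPart (ξ : BrokenLine n) (A : Matrix (Fin n) (Fin n) ℕ) : Matrix (Fin n) (Fin n) ℕ :=
  fun i j => if ξ.LeftUpper (pt i j) then 0 else A i j

open Classical in
/-- `A⁻`: the entries of `A` on the broken line or in its right lower side are replaced by zero. -/
def minusPart (ξ : BrokenLine n) (A : Matrix (Fin n) (Fin n) ℕ) : Matrix (Fin n) (Fin n) ℕ :=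
  fun i j => if ξ.LeftUpper (pt i j) then A i j else 0

theorem plusPart_add_minusPart (ξ : BrokenLine n) (A : Matrix (Fin n) (Fin n) ℕ) :
    ξ.plusPart A + ξ.minusPart A = A := by
  ext i j
  by_cases h : ξ.LeftUpper (pt i j) <;> simp [plusPart, minusPart, h]

end BrokenLine

end QMat

end

/-! The normalization makes $Z(A)$ bar-invariant up to lower terms, so a bar-invariant element with
leading term $Z(A)$ and all other coefficients in $q\mathbb Z[q]$ is determined by $A$; it is
$b(A)$. The theorem follows once a power of $q$ times $b(A^-)b(A^+)$ is seen to have this triangular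
shape.

The only property of the broken line that matters is that the positions on it or to its right lower
side form an upper set $U$ for the product order. Suppose $A$ is supported off $U$ and $B$ on $U$.
If $p\in U$ precedes $r\notin U$ lexicographically, then $p\le r$ fails, so $r$ is strictly below
and to the left of $p$, and $Z_p$, $Z_r$ commute. Hence $Z^AZ^B=Z^{A+B}$ with no straightening
(`Zpow_mul_Zpow`), and $Z(A)Z(B)=q^NZ(A+B)$, where $N$ depends only on row and column sums
(`Znorm_mul_Znorm`). Straightening preserves these sums and also support in any upper or lower set
(`Below`), so the same $N$ serves every pair of terms of $b(A)$ and $b(B)$, and $q^{-N}b(A)b(B)$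
lies in $Z(A+B)+\sum q\mathbb Z[q]Z(C)$ (`mul_sub_mem`).

If the factors $q$-commute, bar multiplies this element by a power of $q$; the leading coefficient
$1$ forces that power to be $1$, so the element is $b(A+B)$. Conversely, bar reverses the product,
so applying it to $b(B)b(A)=q^mb(A+B)$ gives $q$-commutation (`equivalent_iff_qCommuting`).

The foundations are a basis of ordered monomials, whose independence comes from adjoining the
generators one by one in Ore extensions, and Lusztig's triangularity argument for the existence and
uniqueness of $b(A)$ (`exists_sub_bar`, `eq_zero_of_bar_eq`). -/

noncomputable section

namespace QMat

/-! ### Linear independence of the ordered monomials -/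

variable {F : Type} [Field F]

/-- The defining relations of quantum matrices with `n` columns, restricted to the first `m`
positions in the lexicographic order. -/
inductive InitRel (r : F) (n m : ℕ) : FreeAlgebra F (ℕ × ℕ) → FreeAlgebra F (ℕ × ℕ) → Prop
  | row (i j k : ℕ) (h : j < k) (hk : k < n) (hm : i * n + k < m) :
      InitRel r n m (FreeAlgebra.ι F (i, j) * FreeAlgebra.ι F (i, k))
        (r • (FreeAlgebra.ι F (i, k) * FreeAlgebra.ι F (i, j)))
  | col (i k j : ℕ) (h : i < k) (hj : j < n) (hm : k * n + j < m) :
      InitRel r n m (FreeAlgebra.ι F (i, j) * FreeAlgebra.ι F (k, j))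
        (r • (FreeAlgebra.ι F (k, j) * FreeAlgebra.ι F (i, j)))
  | comm (i j s t : ℕ) (h₁ : s < i) (h₂ : j < t) (ht : t < n) (hm : i * n + j < m) :
      InitRel r n m (FreeAlgebra.ι F (i, j) * FreeAlgebra.ι F (s, t))
        (FreeAlgebra.ι F (s, t) * FreeAlgebra.ι F (i, j))
  | cross (i j s t : ℕ) (h₁ : i < s) (h₂ : j < t) (ht : t < n) (hm : s * n + t < m) :
      InitRel r n m (FreeAlgebra.ι F (i, j) * FreeAlgebra.ι F (s, t))
        (FreeAlgebra.ι F (s, t) * FreeAlgebra.ι F (i, j) +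
          (r - r⁻¹) • (FreeAlgebra.ι F (i, t) * FreeAlgebra.ι F (s, j)))

/-- The algebra on the generators at all positions, with the relations between the first `m` of
them. -/
def InitAlg (r : F) (n m : ℕ) : Type := RingQuot (InitRel r n m)

instance (r : F) (n m : ℕ) : Ring (InitAlg r n m) := inferInstanceAs (Ring (RingQuot (InitRel r n m)))

instance (r : F) (n m : ℕ) : Algebra F (InitAlg r n m) :=
  inferInstanceAs (Algebra F (RingQuot (InitRel r n m)))

/-- The quotient map onto `InitAlg r n m`. -/
def initMk (r : F) (n m : ℕ) : FreeAlgebra F (ℕ × ℕ) →ₐ[F] InitAlg r n m :=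
  RingQuot.mkAlgHom F (InitRel r n m)

theorem initMk_rel {r : F} {n m : ℕ} {x y : FreeAlgebra F (ℕ × ℕ)} (h : InitRel r n m x y) :
    initMk r n m x = initMk r n m y :=
  RingQuot.mkAlgHom_rel F h

/-- The generators of `InitAlg r n m`. -/
def initGen (r : F) (n m i j : ℕ) : InitAlg r n m :=
  initMk r n m (FreeAlgebra.ι F (i, j))

theorem code_lt_iff {n i j s t : ℕ} (hj : j < n) (ht : t < n) :
    i * n + j < s * n + t ↔ i < s ∨ i = s ∧ j < t := by
  constructor
  · intro h
    rcases lt_trichotomy i s with h1 | h1 | h1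
    · exact Or.inl h1
    · subst h1; exact Or.inr ⟨rfl, by omega⟩
    · exfalso
      have : (s + 1) * n ≤ i * n := Nat.mul_le_mul_right _ h1
      rw [add_mul] at this
      omega
  · rintro (h | ⟨rfl, h⟩)
    · have : (i + 1) * n ≤ s * n := Nat.mul_le_mul_right _ h
      rw [add_mul] at this
      omega
    · omega

theorem code_eq_iff {n i j s t : ℕ} (hj : j < n) (ht : t < n) :
    i * n + j = s * n + t ↔ i = s ∧ j = t := by
  constructor
  · intro h
    have h1 := (code_lt_iff (i := i) (s := s) hj ht).not.mp (by omega)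
    have h2 := (code_lt_iff (i := s) (s := i) ht hj).not.mp (by omega)
    omega
  · rintro ⟨rfl, rfl⟩; rfl

section Generators

variable {r : F} {n m : ℕ}

theorem initGen_row {i j k : ℕ} (h : j < k) (hk : k < n) (hm : i * n + k < m) :
    initGen r n m i j * initGen r n m i k = r • (initGen r n m i k * initGen r n m i j) := by
  simpa only [map_mul, map_smul, initGen] using
    initMk_rel (InitRel.row i j k h hk hm)

theorem initGen_col {i k j : ℕ} (h : i < k) (hj : j < n) (hm : k * n + j < m) :
    initGen r n m i j * initGen r n m k j = r • (initGen r n m k j * initGen r n m i j) := by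
  simpa only [map_mul, map_smul, initGen] using
    initMk_rel (InitRel.col i k j h hj hm)

theorem initGen_comm {i j s t : ℕ} (h₁ : s < i) (h₂ : j < t) (ht : t < n) (hm : i * n + j < m) :
    initGen r n m i j * initGen r n m s t = initGen r n m s t * initGen r n m i j := by
  simpa only [map_mul, map_smul, initGen] using
    initMk_rel (InitRel.comm i j s t h₁ h₂ ht hm)

theorem initGen_cross {i j s t : ℕ} (h₁ : i < s) (h₂ : j < t) (ht : t < n) (hm : s * n + t < m) :
    initGen r n m i j * initGen r n m s t = initGen r n m s t * initGen r n m i j +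
      (r - r⁻¹) • (initGen r n m i t * initGen r n m s j) := by
  simpa only [map_mul, map_smul, map_add, initGen] using
    initMk_rel (InitRel.cross i j s t h₁ h₂ ht hm)

end Generators

/-- The universal property of `InitAlg`. -/
def initLift {r : F} {n m : ℕ} {B : Type} [Ring B] [Algebra F B]
    (f : FreeAlgebra F (ℕ × ℕ) →ₐ[F] B)
    (h : ∀ ⦃x y : FreeAlgebra F (ℕ × ℕ)⦄, InitRel r n m x y → f x = f y) :
    InitAlg r n m →ₐ[F] B :=
  RingQuot.liftAlgHom F ⟨f, h⟩

theorem initLift_gen {r : F} {n m : ℕ} {B : Type} [Ring B] [Algebra F B]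
    (f : FreeAlgebra F (ℕ × ℕ) →ₐ[F] B)
    (h : ∀ ⦃x y : FreeAlgebra F (ℕ × ℕ)⦄, InitRel r n m x y → f x = f y) (i j : ℕ) :
    initLift f h (initGen r n m i j) = f (FreeAlgebra.ι F (i, j)) :=
  RingQuot.liftAlgHom_mkAlgHom_apply F f h _

theorem initAlg_induction {r : F} {n m : ℕ} {P : InitAlg r n m → Prop}
    (algebraMap : ∀ c : F, P (algebraMap F _ c)) (gen : ∀ i j, P (initGen r n m i j))
    (mul : ∀ a b, P a → P b → P (a * b)) (add : ∀ a b, P a → P b → P (a + b))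
    (a : InitAlg r n m) : P a := by
  obtain ⟨x, rfl⟩ : ∃ x, initMk r n m x = a := RingQuot.mkAlgHom_surjective F _ a
  induction x using FreeAlgebra.induction with
  | grade0 c => rw [AlgHom.commutes]; exact algebraMap c
  | grade1 p => exact gen p.1 p.2
  | mul a b ha hb => rw [map_mul]; exact mul _ _ ha hb
  | add a b ha hb => rw [map_add]; exact add _ _ ha hb

/-! The next position `(s, t)` gives an Ore extension of `InitAlg r n (s * n + t)`. -/

section Ore

variable (r : F) (n s t : ℕ)

/-- The weight of the generator at `(i, j)` under the twist belonging to the position `(s, t)`. -/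
def twistWt (i j : ℕ) : F := (if i = s then r⁻¹ else 1) * (if j = t then r⁻¹ else 1)

/-- The twist of the Ore extension, on generators. -/
def twistGen (i j : ℕ) : InitAlg r n (s * n + t) :=
  twistWt r s t i j • initGen r n (s * n + t) i j

/-- The skew derivation of the Ore extension, on generators. -/
def derivGen (i j : ℕ) : InitAlg r n (s * n + t) :=
  if i < s ∧ j < t then
    (r⁻¹ - r) • (initGen r n (s * n + t) i t * initGen r n (s * n + t) s j)
  else 0

variable {r n s t}

theorem twistWt_of_ne {i j : ℕ} (h : i ≠ s) (h' : j ≠ t) : twistWt r s t i j = 1 := by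
  simp [twistWt, h, h']

theorem twistWt_row {j : ℕ} (h' : j ≠ t) : twistWt r s t s j = r⁻¹ := by
  simp [twistWt, h']

theorem twistWt_col {i : ℕ} (h : i ≠ s) : twistWt r s t i t = r⁻¹ := by
  simp [twistWt, h]

/-- The weight is a row factor times a column factor, so exchanging columns does not change the
product. This is why the twist scales all terms of a cross relation equally. -/
theorem twistWt_exchange (i j k l : ℕ) :
    twistWt r s t i j * twistWt r s t k l = twistWt r s t k j * twistWt r s t i l := by
  simp only [twistWt]; ring

local notation "z" => initGen r n (s * n + t)

/-- The upper right entry of the row relation under $a\mapsto\begin{pmatrix}\sigma a&\delta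
a\\0&a\end{pmatrix}$, that is, compatibility of $\delta$ with the relation through
$\delta(ab)=\sigma(a)\delta(b)+\delta(a)b$. The cases compare the columns with $t$, since $\delta$
vanishes unless the position is strictly above and to the left of $(s,t)$. The next three lemmas
treat the other relations alike. -/
theorem derivGen_row (hr : r ≠ 0) (ht : t < n) {i j k : ℕ} (h : j < k) (hk : k < n)
    (hm : i * n + k < s * n + t) :
    twistGen r n s t i j * derivGen r n s t i k + derivGen r n s t i j * z i k =
      r • (twistGen r n s t i k * derivGen r n s t i j + derivGen r n s t i k * z i j) := by
  have hv {a b : ℕ} (hb : b < n) (h : a < s ∨ a = s ∧ b < t) : a * n + b < s * n + t :=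
    (code_lt_iff hb ht).mpr h
  rcases (code_lt_iff hk ht).mp hm with hi | ⟨hi, -⟩
  swap
  · simp [derivGen, hi]
  by_cases hj : j < t
  swap
  · simp [derivGen, hj, show ¬ k < t by omega]
  have e1 : z s j * z i k = z i k * z s j := initGen_comm hi h hk (hv (by omega) (by omega))
  rcases lt_trichotomy k t with hkt | hkt | hkt
  · have e2 : z i j * z i t = r • (z i t * z i j) := initGen_row hj ht (hv ht (by omega))
    have e3 : z i k * z i t = r • (z i t * z i k) := initGen_row hkt ht (hv ht (by omega))
    have e4 : z i j * z s k = z s k * z i j + (r - r⁻¹) • (z i k * z s j) :=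
      initGen_cross hi h hk (hv (by omega) (by omega))
    have e2' (x) : z i j * (z i t * x) = r • (z i t * (z i j * x)) := by
      rw [← mul_assoc, e2, smul_mul_assoc, mul_assoc]
    have e3' (x) : z i k * (z i t * x) = r • (z i t * (z i k * x)) := by
      rw [← mul_assoc, e3, smul_mul_assoc, mul_assoc]
    simp only [derivGen, twistGen, hi, hj, hkt, and_self, if_true,
      twistWt_of_ne hi.ne hj.ne, twistWt_of_ne hi.ne hkt.ne, one_smul, mul_smul_comm,
      smul_mul_assoc, mul_assoc, e1, e2', e3', e4, mul_add]
    match_scalars <;> field_simp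
    ring
  · obtain rfl := hkt.symm
    simp only [derivGen, twistGen, hi, hj, and_self, if_true, lt_irrefl, and_false, if_false,
      twistWt_col hi.ne, mul_smul_comm, smul_mul_assoc, mul_assoc, e1, mul_zero, zero_mul]
    match_scalars
    field_simp
  · have e2 : z i t * z i k = r • (z i k * z i t) := initGen_row hkt hk (hv hk (by omega))
    have e2' (x) : z i t * (z i k * x) = r • (z i k * (z i t * x)) := by
      rw [← mul_assoc, e2, smul_mul_assoc, mul_assoc]
    simp only [derivGen, twistGen, hi, hj, and_self, if_true, hkt.not_gt, and_false, if_false,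
      twistWt_of_ne hi.ne hkt.ne', mul_smul_comm, smul_mul_assoc, mul_assoc, e1, e2', mul_zero,
      zero_mul]
    match_scalars
    field_simp

theorem derivGen_col (hr : r ≠ 0) (ht : t < n) {i k j : ℕ} (h : i < k) (hj : j < n)
    (hm : k * n + j < s * n + t) :
    twistGen r n s t i j * derivGen r n s t k j + derivGen r n s t i j * z k j =
      r • (twistGen r n s t k j * derivGen r n s t i j + derivGen r n s t k j * z i j) := by
  have hv {a b : ℕ} (hb : b < n) (h : a < s ∨ a = s ∧ b < t) : a * n + b < s * n + t :=
    (code_lt_iff hb ht).mpr h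
  by_cases hjt : j < t
  swap
  · simp [derivGen, hjt]
  rcases (code_lt_iff hj ht).mp hm with hk | ⟨hks, -⟩
  · have hi : i < s := by omega
    have e1 : z s j * z k j = r⁻¹ • (z k j * z s j) := by
      rw [initGen_col hk hj (hv hj (by omega)), smul_smul, inv_mul_cancel₀ hr,
        one_smul]
    have e2 : z s j * z i j = r⁻¹ • (z i j * z s j) := by
      rw [initGen_col hi hj (hv hj (by omega)), smul_smul, inv_mul_cancel₀ hr,
        one_smul]
    have e3 : z i j * z k t = z k t * z i j + (r - r⁻¹) • (z i t * z k j) :=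
      initGen_cross h hjt ht (hv ht (by omega))
    have e3' (x) : z i j * (z k t * x) =
        z k t * (z i j * x) + (r - r⁻¹) • (z i t * (z k j * x)) := by
      rw [← mul_assoc, e3, add_mul, smul_mul_assoc, mul_assoc, mul_assoc]
    have e4 (x) : z k j * (z i t * x) = z i t * (z k j * x) := by
      rw [← mul_assoc, initGen_comm h hjt ht (hv hj (by omega)), mul_assoc]
    simp only [derivGen, twistGen, hi, hjt, hk, and_self, if_true,
      twistWt_of_ne hi.ne hjt.ne, twistWt_of_ne hk.ne hjt.ne, one_smul, mul_smul_comm,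
      smul_mul_assoc, mul_assoc, e1, e2, e3', e4, smul_add]
    match_scalars
    field_simp
    ring
  · obtain rfl := hks.symm
    have e4 (x) : z s j * (z i t * x) = z i t * (z s j * x) := by
      rw [← mul_assoc, initGen_comm h hjt ht (hv hj (by omega)), mul_assoc]
    simp only [derivGen, twistGen, h, hjt, and_self, if_true, lt_irrefl, false_and, if_false,
      twistWt_row hjt.ne, mul_smul_comm, smul_mul_assoc, mul_assoc, e4, mul_zero, zero_mul]
    match_scalars
    field_simp

theorem derivGen_comm (hr : r ≠ 0) (ht : t < n) {i j u v : ℕ} (h₁ : u < i) (h₂ : j < v) (hvn : v < n)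
    (hm : i * n + j < s * n + t) :
    twistGen r n s t i j * derivGen r n s t u v + derivGen r n s t i j * z u v =
      twistGen r n s t u v * derivGen r n s t i j + derivGen r n s t u v * z i j := by
  have hv {a b : ℕ} (hb : b < n) (h : a < s ∨ a = s ∧ b < t) : a * n + b < s * n + t :=
    (code_lt_iff hb ht).mpr h
  have hj : j < n := by omega
  by_cases hjt : j < t
  swap
  · simp [derivGen, hjt, show ¬ v < t by omega]
  rcases (code_lt_iff hj ht).mp hm with hi | ⟨his, -⟩
  · have e1 : z s j * z u v = z u v * z s j :=
      initGen_comm (by omega) h₂ hvn (hv hj (by omega))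
    rcases lt_trichotomy v t with hvt | hvt | hvt
    · have e2 (x) : z i j * (z u t * x) = z u t * (z i j * x) := by
        rw [← mul_assoc, initGen_comm h₁ hjt ht (hv hj (by omega)), mul_assoc]
      have e3 : z i j * z s v = z s v * z i j + (r - r⁻¹) • (z i v * z s j) :=
        initGen_cross hi h₂ hvn (hv hvn (by omega))
      have e4 (x) : z u v * (z i t * x) =
          z i t * (z u v * x) + (r - r⁻¹) • (z u t * (z i v * x)) := by
        rw [← mul_assoc, initGen_cross h₁ hvt ht (hv ht (by omega)), add_mul, smul_mul_assoc,
          mul_assoc, mul_assoc]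
      have hu : u < s := by omega
      simp only [derivGen, twistGen, hi, hjt, hvt, hu, and_self, if_true,
        twistWt_of_ne hi.ne hjt.ne, twistWt_of_ne hu.ne hvt.ne, one_smul, mul_smul_comm,
        smul_mul_assoc, mul_assoc, e1, e2, e3, e4, smul_add, mul_add]
      match_scalars <;> field_simp
    · obtain rfl := hvt.symm
      have hu : u < s := by omega
      have e2 (x) : z u t * (z i t * x) = r • (z i t * (z u t * x)) := by
        rw [← mul_assoc, initGen_col h₁ ht (hv ht (by omega)), smul_mul_assoc, mul_assoc]
      simp only [derivGen, twistGen, hi, hjt, hu, and_self, if_true, lt_irrefl, and_false,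
        if_false, twistWt_col hu.ne, mul_smul_comm,
        smul_mul_assoc, mul_assoc, e1, e2, mul_zero, zero_mul]
      match_scalars
      field_simp
    · have hu : u < s := by omega
      have e2 (x) : z i t * (z u v * x) = z u v * (z i t * x) := by
        rw [← mul_assoc, initGen_comm h₁ hvt hvn (hv ht (by omega)), mul_assoc]
      simp only [derivGen, twistGen, hi, hjt, hu, and_self, if_true, hvt.not_gt, and_false,
        if_false, twistWt_of_ne hu.ne hvt.ne', mul_smul_comm,
        smul_mul_assoc, mul_assoc, e1, e2, mul_zero, zero_mul, one_smul, zero_add, add_zero]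
  · obtain rfl := his.symm
    by_cases hvt : v < t
    swap
    · simp [derivGen, hvt]
    have e2 (x) : z s j * (z u t * x) = z u t * (z s j * x) := by
      rw [← mul_assoc, initGen_comm h₁ hjt ht (hv hj (by omega)), mul_assoc]
    have e3 : z s j * z s v = r • (z s v * z s j) := initGen_row h₂ hvn (hv hvn (by omega))
    simp only [derivGen, twistGen, h₁, hjt, hvt, and_self, if_true, lt_irrefl, false_and,
      if_false, twistWt_row hjt.ne, mul_smul_comm,
      smul_mul_assoc, mul_assoc, e2, e3, mul_zero, zero_mul]
    match_scalars
    field_simp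

theorem derivGen_cross (hr : r ≠ 0) (ht : t < n) {i j u v : ℕ} (h₁ : i < u) (h₂ : j < v) (hvn : v < n)
    (hm : u * n + v < s * n + t) :
    twistGen r n s t i j * derivGen r n s t u v + derivGen r n s t i j * z u v =
      twistGen r n s t u v * derivGen r n s t i j + derivGen r n s t u v * z i j +
        (r - r⁻¹) •
          (twistGen r n s t i v * derivGen r n s t u j + derivGen r n s t i v * z u j) := by
  have hv {a b : ℕ} (hb : b < n) (h : a < s ∨ a = s ∧ b < t) : a * n + b < s * n + t :=
    (code_lt_iff hb ht).mpr h
  have hj : j < n := by omega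
  by_cases hjt : j < t
  swap
  · simp [derivGen, hjt, show ¬ v < t by omega]
  rcases (code_lt_iff hvn ht).mp hm with hu | ⟨hus, hvt⟩
  · have hi : i < s := by omega
    have e1 : z s j * z u v = z u v * z s j :=
      initGen_comm (by omega) h₂ hvn (hv hj (by omega))
    rcases lt_trichotomy v t with hvt | hvt | hvt
    · have e2 (x) : z i j * (z u t * x) =
          z u t * (z i j * x) + (r - r⁻¹) • (z i t * (z u j * x)) := by
        rw [← mul_assoc, initGen_cross h₁ hjt ht (hv ht (by omega)), add_mul, smul_mul_assoc,
          mul_assoc, mul_assoc]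
      have e3 : z i j * z s v = z s v * z i j + (r - r⁻¹) • (z i v * z s j) :=
        initGen_cross hi h₂ hvn (hv hvn (by omega))
      have e4 : z u j * z s v = z s v * z u j + (r - r⁻¹) • (z u v * z s j) :=
        initGen_cross hu h₂ hvn (hv hvn (by omega))
      have e5 (x) : z u v * (z i t * x) = z i t * (z u v * x) := by
        rw [← mul_assoc, initGen_comm h₁ hvt ht (hv hvn (by omega)), mul_assoc]
      have e6 (x) : z i v * (z u t * x) =
          z u t * (z i v * x) + (r - r⁻¹) • (z i t * (z u v * x)) := by
        rw [← mul_assoc, initGen_cross h₁ hvt ht (hv ht (by omega)), add_mul, smul_mul_assoc,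
          mul_assoc, mul_assoc]
      simp only [derivGen, twistGen, hi, hjt, hvt, hu, and_self, if_true,
        twistWt_of_ne hi.ne hjt.ne, twistWt_of_ne hu.ne hvt.ne, twistWt_of_ne hi.ne hvt.ne,
        one_smul, mul_smul_comm,
        smul_mul_assoc, mul_assoc, e1, e2, e3, e4, e5, e6, smul_add, mul_add]
      match_scalars <;> field_simp
      ring
    · obtain rfl := hvt.symm
      have e2 (x) : z i t * (z u t * x) = r • (z u t * (z i t * x)) := by
        rw [← mul_assoc, initGen_col h₁ ht (hv ht (by omega)), smul_mul_assoc, mul_assoc]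
      simp only [derivGen, twistGen, hi, hjt, hu, and_self, if_true, lt_irrefl, and_false,
        if_false, twistWt_col hu.ne, twistWt_col hi.ne, mul_smul_comm,
        smul_mul_assoc, mul_assoc, e1, e2, mul_zero, zero_mul]
      match_scalars
      field_simp
      ring
    · have e2 (x) : z i t * (z u v * x) =
          z u v * (z i t * x) + (r - r⁻¹) • (z i v * (z u t * x)) := by
        rw [← mul_assoc, initGen_cross h₁ hvt hvn (hv hvn (by omega)), add_mul, smul_mul_assoc,
          mul_assoc, mul_assoc]
      simp only [derivGen, twistGen, hi, hjt, hu, and_self, if_true, hvt.not_gt, and_false,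
        if_false, twistWt_of_ne hu.ne hvt.ne', twistWt_of_ne hi.ne hvt.ne', mul_smul_comm,
        smul_mul_assoc, mul_assoc, e1, e2, mul_zero, zero_mul, one_smul, smul_add]
      match_scalars <;> field_simp
  · obtain rfl := hus.symm
    have e2 (x) : z s v * (z i t * x) = z i t * (z s v * x) := by
      rw [← mul_assoc, initGen_comm h₁ hvt ht (hv hvn (by omega)), mul_assoc]
    have e3 : z s j * z s v = r • (z s v * z s j) := initGen_row h₂ hvn (hv hvn (by omega))
    simp only [derivGen, twistGen, h₁, hjt, hvt, and_self, if_true, lt_irrefl, false_and,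
      if_false, twistWt_row hvt.ne, mul_smul_comm,
      smul_mul_assoc, mul_assoc, e2, e3, mul_zero, zero_mul]
    match_scalars
    field_simp
    ring

/-- The twist `σ` and the skew derivation `δ`, as the homomorphism `a ↦ (σ a, δ a; 0, a)`. -/
def skewHom (hr : r ≠ 0) (ht : t < n) :
    InitAlg r n (s * n + t) →ₐ[F] Matrix (Fin 2) (Fin 2) (InitAlg r n (s * n + t)) :=
  initLift
    (FreeAlgebra.lift F fun p =>
      !![twistGen r n s t p.1 p.2, derivGen r n s t p.1 p.2; 0, z p.1 p.2]) <| by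
    intro x y h
    induction h with
    | row i j k h hk hm =>
      have e := derivGen_row hr ht h hk hm
      have f : twistGen r n s t i j * twistGen r n s t i k =
          r • (twistGen r n s t i k * twistGen r n s t i j) := by
        simp only [twistGen, smul_mul_smul_comm, initGen_row h hk hm, smul_smul]
        congr 1; ring
      simp only [map_mul, map_smul, FreeAlgebra.lift_ι_apply, Matrix.mul_fin_two, e, f,
        initGen_row h hk hm, mul_zero, zero_mul, add_zero, zero_add]
      ext a b
      fin_cases a <;> fin_cases b <;> simp
    | col i k j h hj hm =>
      have e := derivGen_col hr ht h hj hm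
      have f : twistGen r n s t i j * twistGen r n s t k j =
          r • (twistGen r n s t k j * twistGen r n s t i j) := by
        simp only [twistGen, smul_mul_smul_comm, initGen_col h hj hm, smul_smul]
        congr 1; ring
      simp only [map_mul, map_smul, FreeAlgebra.lift_ι_apply, Matrix.mul_fin_two, e, f,
        initGen_col h hj hm, mul_zero, zero_mul, add_zero, zero_add]
      ext a b
      fin_cases a <;> fin_cases b <;> simp
    | comm i j u v h₁ h₂ hv hm =>
      have e := derivGen_comm hr ht h₁ h₂ hv hm
      have f : twistGen r n s t i j * twistGen r n s t u v =
          twistGen r n s t u v * twistGen r n s t i j := by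
        simp only [twistGen, smul_mul_smul_comm, initGen_comm h₁ h₂ hv hm]
        congr 1; ring
      simp only [map_mul, FreeAlgebra.lift_ι_apply, Matrix.mul_fin_two, e, f,
        initGen_comm h₁ h₂ hv hm, mul_zero, zero_mul, add_zero, zero_add]
    | cross i j u v h₁ h₂ hv hm =>
      have e := derivGen_cross hr ht h₁ h₂ hv hm
      have f : twistGen r n s t i j * twistGen r n s t u v =
          twistGen r n s t u v * twistGen r n s t i j +
            (r - r⁻¹) • (twistGen r n s t i v * twistGen r n s t u j) := by
        simp only [twistGen, smul_mul_smul_comm, initGen_cross h₁ h₂ hv hm, smul_add]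
        rw [twistWt_exchange i v u j, mul_comm (twistWt r s t u v),
          smul_comm (r - r⁻¹) (_ : F)]
      simp only [map_mul, map_add, map_smul, FreeAlgebra.lift_ι_apply, Matrix.mul_fin_two, e, f,
        initGen_cross h₁ h₂ hv hm, mul_zero, zero_mul, add_zero, zero_add]
      ext a b
      fin_cases a <;> fin_cases b <;> simp

theorem skewHom_gen (hr : r ≠ 0) (ht : t < n) (i j : ℕ) :
    skewHom hr ht (z i j) = !![twistGen r n s t i j, derivGen r n s t i j; 0, z i j] := by
  rw [skewHom, initLift_gen, FreeAlgebra.lift_ι_apply]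

/-- With bottom row $(0,a)$, multiplicativity of the matrix map says that its entry `0 0` is an
algebra map $\sigma$ and its entry `0 1` a $\sigma$-derivation $\delta$. -/
theorem skewHom_one (hr : r ≠ 0) (ht : t < n) (a : InitAlg r n (s * n + t)) :
    skewHom hr ht a 1 0 = 0 ∧ skewHom hr ht a 1 1 = a := by
  induction a using initAlg_induction with
  | algebraMap c => simp [Matrix.algebraMap_matrix_apply]
  | gen i j => simp [skewHom_gen]
  | mul a b ha hb => simp [Matrix.mul_apply, Fin.sum_univ_two, ha, hb]
  | add a b ha hb => simp [ha, hb]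

/-- Left multiplication by the next generator on the Ore extension, the elements of which are
written as sequences of left coefficients. -/
def oreMul (hr : r ≠ 0) (ht : t < n) : Module.End F (ℕ → InitAlg r n (s * n + t)) where
  toFun f k := (match k with
    | 0 => 0
    | k + 1 => skewHom hr ht (f k) 0 0) + skewHom hr ht (f k) 0 1
  map_add' f g := by
    funext k
    cases k <;> simp
    abel
  map_smul' c f := by
    funext k
    cases k <;> simp

/-- The Ore rule $X(af)=\sigma(a)Xf+\delta(a)f$, where $f$ stands for $\sum f_kX^k$. -/
theorem oreMul_smul (hr : r ≠ 0) (ht : t < n) (a : InitAlg r n (s * n + t))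
    (f : ℕ → InitAlg r n (s * n + t)) :
    oreMul hr ht (a • f) =
      skewHom hr ht a 0 0 • oreMul hr ht f + skewHom hr ht a 0 1 • f := by
  funext k
  cases k <;> simp [oreMul, Matrix.mul_apply, Fin.sum_univ_two, skewHom_one, mul_add, add_assoc]

theorem oreMul_single (hr : r ≠ 0) (ht : t < n) (k : ℕ) :
    oreMul (s := s) hr ht (Pi.single k 1) = Pi.single (k + 1) 1 := by
  have h (i j : ℕ) : (Pi.single i 1 : ℕ → InitAlg r n (s * n + t)) j = if j = i then 1 else 0 := by
    simp [Pi.single_apply]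
  funext l
  cases l <;> simp only [oreMul, LinearMap.coe_mk, AddHom.coe_mk, h]
  · rw [if_neg (Nat.succ_ne_zero k).symm]
    split_ifs <;> simp
  · simp only [add_left_inj]
    split_ifs <;> simp

/-- The action of the generators on the Ore extension. -/
def oreGen (hr : r ≠ 0) (ht : t < n) (i j : ℕ) : Module.End F (ℕ → InitAlg r n (s * n + t)) :=
  if i = s ∧ j = t then oreMul hr ht else Algebra.lsmul F F (ℕ → InitAlg r n (s * n + t)) (z i j)

theorem oreGen_self (hr : r ≠ 0) (ht : t < n) : oreGen (s := s) hr ht s t = oreMul hr ht := by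
  simp [oreGen]

theorem oreGen_of_lt (hr : r ≠ 0) (ht : t < n) {i j : ℕ} (h : i < s ∨ i = s ∧ j < t) :
    oreGen hr ht i j = Algebra.lsmul F F (ℕ → InitAlg r n (s * n + t)) (z i j) := by
  rw [oreGen, if_neg (by omega)]

theorem lsmul_mul_oreMul (hr : r ≠ 0) (ht : t < n) (i j : ℕ) :
    oreMul hr ht * Algebra.lsmul F F (ℕ → InitAlg r n (s * n + t)) (z i j) =
      twistWt r s t i j • (Algebra.lsmul F F (ℕ → InitAlg r n (s * n + t)) (z i j) * oreMul hr ht) +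
        Algebra.lsmul F F (ℕ → InitAlg r n (s * n + t)) (derivGen r n s t i j) := by
  refine LinearMap.ext fun f => ?_
  simp only [Module.End.mul_apply, Algebra.lsmul_coe, LinearMap.add_apply, LinearMap.smul_apply]
  rw [oreMul_smul, skewHom_gen]
  simp [twistGen]

/-- The action on the Ore extension. -/
def oreHom (hr : r ≠ 0) (ht : t < n) :
    InitAlg r n (s * n + t + 1) →ₐ[F] Module.End F (ℕ → InitAlg r n (s * n + t)) :=
  initLift (FreeAlgebra.lift F fun p => oreGen hr ht p.1 p.2) <| by
    -- The largest position of a relation either precedes $(s,t)$, and the relation already holds in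
    -- the smaller algebra, or equals $(s,t)$, and the relation is an instance of the Ore rule.
    have hv {a b : ℕ} (hb : b < n) (h : a * n + b < s * n + t + 1) :
        a * n + b < s * n + t ∧ (a < s ∨ a = s ∧ b < t) ∨ a = s ∧ b = t := by
      rcases Nat.lt_succ_iff_lt_or_eq.mp h with h | h
      · exact Or.inl ⟨h, (code_lt_iff hb ht).mp h⟩
      · exact Or.inr ((code_eq_iff hb ht).mp h)
    intro x y h
    induction h with
    | row i j k h hk hm =>
      simp only [map_mul, map_smul, FreeAlgebra.lift_ι_apply]
      rcases hv hk hm with ⟨hm, h'⟩ | ⟨h₁, h₂⟩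
      · rw [oreGen_of_lt hr ht h', oreGen_of_lt hr ht (by omega), ← map_mul, ← map_mul,
          initGen_row h hk hm, map_smul]
      · rw [h₁, h₂, oreGen_self, oreGen_of_lt hr ht (by omega), lsmul_mul_oreMul,
          twistWt_row (by omega), derivGen, if_neg (by omega), map_zero, add_zero, smul_smul,
          mul_inv_cancel₀ hr, one_smul]
    | col i k j h hj hm =>
      simp only [map_mul, map_smul, FreeAlgebra.lift_ι_apply]
      rcases hv hj hm with ⟨hm, h'⟩ | ⟨h₁, h₂⟩
      · rw [oreGen_of_lt hr ht h', oreGen_of_lt hr ht (by omega), ← map_mul, ← map_mul,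
          initGen_col h hj hm, map_smul]
      · rw [h₁, h₂, oreGen_self, oreGen_of_lt hr ht (by omega), lsmul_mul_oreMul,
          twistWt_col (by omega), derivGen, if_neg (by omega), map_zero, add_zero, smul_smul,
          mul_inv_cancel₀ hr, one_smul]
    | comm i j u v h h' hvn hm =>
      simp only [map_mul, FreeAlgebra.lift_ι_apply]
      rcases hv (by omega) hm with ⟨hm, hl⟩ | ⟨h₁, h₂⟩
      · rw [oreGen_of_lt hr ht hl, oreGen_of_lt hr ht (by omega), ← map_mul, ← map_mul,
          initGen_comm h h' hvn hm]
      · rw [h₁, h₂, oreGen_self, oreGen_of_lt hr ht (by omega), lsmul_mul_oreMul,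
          twistWt_of_ne (by omega) (by omega), derivGen, if_neg (by omega), map_zero, add_zero,
          one_smul]
    | cross i j u v h h' hvn hm =>
      simp only [map_mul, map_add, map_smul, FreeAlgebra.lift_ι_apply]
      rcases hv hvn hm with ⟨hm, hl⟩ | ⟨h₁, h₂⟩
      · rw [oreGen_of_lt hr ht hl, oreGen_of_lt hr ht (by omega), oreGen_of_lt hr ht (by omega),
          oreGen_of_lt hr ht (by omega), ← map_mul, ← map_mul, ← map_mul,
          initGen_cross h h' hvn hm, map_add, map_smul]
      · rw [h₁, h₂, oreGen_self, oreGen_of_lt hr ht (by omega), oreGen_of_lt hr ht (by omega),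
          oreGen_of_lt hr ht (by omega), lsmul_mul_oreMul,
          twistWt_of_ne (by omega) (by omega), derivGen, if_pos (by omega), map_smul, map_mul,
          one_smul, add_assoc, ← add_smul]
        simp

theorem oreHom_gen (hr : r ≠ 0) (ht : t < n) (i j : ℕ) :
    oreHom (s := s) hr ht (initGen r n (s * n + t + 1) i j) = oreGen hr ht i j := by
  rw [oreHom, initLift_gen, FreeAlgebra.lift_ι_apply]

end Ore

/-! ### Independence by induction on the number of positions -/

/-- The monomials in the first `m` generators, in the lexicographic order. -/
def initMono (r : F) (n m : ℕ) (e : Fin m → ℕ) : InitAlg r n m :=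
  (List.ofFn fun k : Fin m => initGen r n m (k / n) (k % n) ^ e k).prod

/-- The last generator stands rightmost, so it acts first and turns $1$ into $X^k$; the earlier
generators then only multiply the coefficient from the left. No commutation is needed. -/
theorem oreHom_initMono {r : F} {n s t : ℕ} (hr : r ≠ 0) (ht : t < n)
    (e : Fin (s * n + t + 1) → ℕ) :
    oreHom hr ht (initMono r n (s * n + t + 1) e) (Pi.single 0 1) =
      Pi.single (e (Fin.last _)) (initMono r n (s * n + t) (Fin.init e)) := by
  have hX (k : ℕ) : (oreMul (s := s) hr ht ^ k) (Pi.single 0 1) = Pi.single k 1 := by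
    induction k with
    | zero => simp
    | succ k ih => rw [pow_succ', Module.End.mul_apply, ih, oreMul_single]
  have hn : 0 < n := by omega
  have hc : oreHom hr ht
        (List.ofFn fun k : Fin (s * n + t) => initGen r n (s * n + t + 1)
          ((k.castSucc : ℕ) / n) ((k.castSucc : ℕ) % n) ^ e k.castSucc).prod =
      Algebra.lsmul F F (ℕ → InitAlg r n (s * n + t)) (initMono r n (s * n + t) (Fin.init e)) := by
    rw [initMono, map_list_prod, map_list_prod, List.map_ofFn, List.map_ofFn]
    congr 2
    funext k
    have hk := k.2
    rw [← Nat.div_add_mod' (k : ℕ) n, code_lt_iff (Nat.mod_lt _ hn) ht] at hk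
    simp only [Function.comp, Fin.val_castSucc, map_pow, oreHom_gen, oreGen_of_lt hr ht hk]
    rfl
  rw [initMono, List.ofFn_succ', List.concat_eq_append, List.prod_append, map_mul, hc,
    List.prod_singleton, Fin.val_last, Nat.add_div_of_dvd_right (Dvd.intro_left s rfl),
    Nat.mul_div_cancel _ hn, Nat.div_eq_of_lt ht, Nat.mul_add_mod_of_lt ht, add_zero, map_pow,
    oreHom_gen, oreGen_self, Module.End.mul_apply, hX, Algebra.lsmul_coe]
  funext k
  simp [Pi.single_apply]

theorem linearIndependent_initMono {r : F} (hr : r ≠ 0) {n m : ℕ} (hm : m ≤ n * n) :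
    LinearIndependent F (initMono r n m) := by
  induction m with
  | zero =>
    rw [linearIndependent_unique_iff]
    intro h
    -- There are no relations when $m=0$, so all generators may be sent to $0$; the empty monomial
    -- still goes to $1$, hence is nonzero.
    have hrel : ∀ ⦃x y : FreeAlgebra F (ℕ × ℕ)⦄, InitRel r n 0 x y →
        FreeAlgebra.lift F (fun _ => (0 : F)) x = FreeAlgebra.lift F (fun _ => (0 : F)) y := by
      rintro x y (h | h | h | h) <;> omega
    have := congrArg (initLift _ hrel) h
    simp [initMono] at this
  | succ m ih =>
    have hn : 0 < n := by by_contra! h; simp_all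
    replace ih := ih (by omega)
    obtain ⟨s, t, ht, rfl⟩ : ∃ s t, t < n ∧ m = s * n + t :=
      ⟨m / n, m % n, Nat.mod_lt _ hn, (Nat.div_add_mod' m n).symm⟩
    refine LinearIndependent.of_comp ((LinearMap.applyₗ (Pi.single 0 1)).comp
      (oreHom (s := s) hr ht).toLinearMap) ?_
    -- Independent coefficients placed in the various degrees $X^k$ remain independent; the next
    -- step views finitely supported sequences inside all sequences.
    have h1 := Finsupp.linearIndependent_single (R := F) (ι := ℕ) _ fun _ => ih
    have h2 := h1.map' (Finsupp.lcoeFun (R := F)) (LinearMap.ker_eq_bot.mpr DFunLike.coe_injective)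
    have hinj : Function.Injective fun e : Fin (s * n + t + 1) → ℕ =>
        (⟨e (Fin.last _), Fin.init e⟩ : Σ _ : ℕ, Fin (s * n + t) → ℕ) := by
      intro e e' h
      simp only [Sigma.mk.injEq, heq_eq_eq] at h
      rw [← Fin.snoc_init_self e, ← Fin.snoc_init_self e', h.1, h.2]
    have heq : ((LinearMap.applyₗ (Pi.single 0 1)).comp (oreHom (s := s) hr ht).toLinearMap) ∘
        initMono r n (s * n + t + 1) = (Finsupp.lcoeFun (R := F) ∘
          fun ix : Σ _ : ℕ, Fin (s * n + t) → ℕ =>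
            Finsupp.single ix.1 (initMono r n (s * n + t) ix.2)) ∘
              fun e => ⟨e (Fin.last _), Fin.init e⟩ := by
      funext e
      refine (oreHom_initMono hr ht e).trans ?_
      exact (Finsupp.single_eq_pi_single _ _).symm
    rw [heq]
    exact h2.comp _ hinj

/-! ### Transfer to $O_q(M(n))$ -/

/-- The map from `O_q(M(n))` to the algebra in which all positions have been adjoined. -/
def toInit (n : ℕ) : Oq n →ₐ[K] InitAlg (q ^ 2) n (n * n) :=
  RingQuot.liftAlgHom K ⟨FreeAlgebra.lift K fun p => initGen (q ^ 2) n (n * n) p.1 p.2, by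
    have hv (i j : Fin n) : (i : ℕ) * n + j < n * n := by
      simpa using (code_lt_iff (t := 0) j.2 j.pos).mpr (Or.inl i.2)
    intro x y h
    induction h with
    | row i j k h =>
      simp only [map_mul, map_smul, FreeAlgebra.lift_ι_apply]
      exact initGen_row h k.2 (hv i k)
    | col i k j h =>
      simp only [map_mul, map_smul, FreeAlgebra.lift_ι_apply]
      exact initGen_col h j.2 (hv k j)
    | comm i j s t h₁ h₂ =>
      simp only [map_mul, FreeAlgebra.lift_ι_apply]
      exact initGen_comm h₁ h₂ t.2 (hv i j)
    | cross i j s t h₁ h₂ =>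
      simp only [map_mul, map_smul, map_add, FreeAlgebra.lift_ι_apply]
      exact initGen_cross h₁ h₂ t.2 (hv s t)⟩

theorem toInit_Zgen {n : ℕ} (i j : Fin n) : toInit n (Zgen i j) = initGen (q ^ 2) n (n * n) i j := by
  rw [toInit, Zgen, RingQuot.liftAlgHom_mkAlgHom_apply, FreeAlgebra.lift_ι_apply]

theorem toInit_Zpow {n : ℕ} (A : Matrix (Fin n) (Fin n) ℕ) :
    toInit n (Zpow A) =
      initMono (q ^ 2) n (n * n) fun k => A (finProdFinEquiv.symm k).1 (finProdFinEquiv.symm k).2 := by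
  rw [initMono, List.ofFn_mul, List.prod_flatten, List.map_ofFn, Zpow, map_list_prod,
    List.map_ofFn]
  congr 2
  funext i
  simp only [Function.comp, map_list_prod, List.map_ofFn]
  congr 2
  funext j
  have hn : 0 < n := j.pos
  have h1 : ((i : ℕ) * n + j) / n = i := by
    rw [Nat.add_div_of_dvd_right (Dvd.intro_left _ rfl), Nat.mul_div_cancel _ hn,
      Nat.div_eq_of_lt j.2, add_zero]
  have h2 : ((i : ℕ) * n + j) % n = j := Nat.mul_add_mod_of_lt j.2
  simp only [Function.comp, map_pow, toInit_Zgen, finProdFinEquiv_symm_apply, h1, h2]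
  congr 2 <;> ext <;> simp [Fin.divNat, Fin.modNat, h1, h2]

/-- Independence pulls back along any linear map, so a homomorphism to the iterated extension
suffices; it need not be an isomorphism. -/
theorem linearIndependent_Zpow (n : ℕ) :
    LinearIndependent K (Zpow : Matrix (Fin n) (Fin n) ℕ → Oq n) := by
  refine LinearIndependent.of_comp (toInit n).toLinearMap ?_
  have hinj : Function.Injective fun (A : Matrix (Fin n) (Fin n) ℕ) (k : Fin (n * n)) =>
      A (finProdFinEquiv.symm k).1 (finProdFinEquiv.symm k).2 := by
    intro A B h
    ext i j
    simpa only [Equiv.symm_apply_apply] using congrFun h (finProdFinEquiv (i, j))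
  have heq : (toInit n).toLinearMap ∘ Zpow = initMono (q ^ 2) n (n * n) ∘
      fun (A : Matrix (Fin n) (Fin n) ℕ) (k : Fin (n * n)) =>
        A (finProdFinEquiv.symm k).1 (finProdFinEquiv.symm k).2 :=
    funext toInit_Zpow
  rw [heq]
  exact (linearIndependent_initMono (pow_ne_zero 2 q_ne_zero) le_rfl).comp _ hinj

theorem linearIndependent_Znorm (n : ℕ) :
    LinearIndependent K (Znorm : Matrix (Fin n) (Fin n) ℕ → Oq n) := by
  have h := (linearIndependent_Zpow n).units_smul fun A => Units.mk0 q q_ne_zero ^ (-(dexp A : ℤ))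
  have e : ((fun A : Matrix (Fin n) (Fin n) ℕ => Units.mk0 q q_ne_zero ^ (-(dexp A : ℤ))) • Zpow) =
      (Znorm : Matrix (Fin n) (Fin n) ℕ → Oq n) := by
    funext A
    simp [Znorm, Units.smul_def]
  rwa [e] at h

/-! ### The lexicographic order of matrices -/

section Order

variable {n : ℕ}

/-- A matrix as an element of the lexicographically ordered product over the positions. -/
def lexEmb (A : Matrix (Fin n) (Fin n) ℕ) : Lex (Fin n ×ₗ Fin n → ℕ) :=
  toLex fun p => A (ofLex p).1 (ofLex p).2

theorem lexEmb_injective : Function.Injective (lexEmb (n := n)) := by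
  intro A B h
  ext i j
  exact congrFun (toLex.injective h) (toLex (i, j))

theorem lexLT_iff {B A : Matrix (Fin n) (Fin n) ℕ} : LexLT B A ↔ lexEmb B < lexEmb A := by
  constructor
  · rintro ⟨i, j, h, h'⟩
    refine ⟨toLex (i, j), fun p hp => ?_, h'⟩
    exact h _ _ (Prod.Lex.lt_iff.mp hp)
  · rintro ⟨p, h, h'⟩
    exact ⟨(ofLex p).1, (ofLex p).2, fun s t hst => h (toLex (s, t)) (Prod.Lex.lt_iff.mpr hst), h'⟩

theorem LexLT.trans {A B C : Matrix (Fin n) (Fin n) ℕ} (h : LexLT C B) (h' : LexLT B A) :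
    LexLT C A :=
  lexLT_iff.mpr ((lexLT_iff.mp h).trans (lexLT_iff.mp h'))

theorem LexLT.ne {A B : Matrix (Fin n) (Fin n) ℕ} (h : LexLT B A) : B ≠ A := by
  rintro rfl
  exact lt_irrefl _ (lexLT_iff.mp h)

/-- There are finitely many positions with entries in $\mathbb N$, so descending inductions on the
content or on the leading term terminate. -/
theorem lexLT_wf : WellFounded (LexLT (n := n)) := by
  have h : WellFounded ((· < ·) : Lex (Fin n ×ₗ Fin n → ℕ) → _ → Prop) := wellFounded_lt
  exact (InvImage.wf lexEmb h).mono fun _ _ => lexLT_iff.mp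

theorem LexLT.add_left {A B : Matrix (Fin n) (Fin n) ℕ} (h : LexLT B A)
    (C : Matrix (Fin n) (Fin n) ℕ) : LexLT (C + B) (C + A) := by
  obtain ⟨i, j, h, h'⟩ := h
  exact ⟨i, j, fun s t hst => by simp [h s t hst], by simpa using h'⟩

theorem ro_add (A B : Matrix (Fin n) (Fin n) ℕ) : ro (A + B) = ro A + ro B := by
  funext i; simp [ro, Finset.sum_add_distrib]

theorem co_add (A B : Matrix (Fin n) (Fin n) ℕ) : co (A + B) = co A + co B := by
  funext i; simp [co, Finset.sum_add_distrib]

theorem ro_single (i j : Fin n) : ro (Matrix.single i j 1) = Pi.single i 1 := by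
  funext k
  simp [ro, Matrix.single_apply, Pi.single_apply, ite_and, eq_comm (a := k)]

theorem co_single (i j : Fin n) : co (Matrix.single i j 1) = Pi.single j 1 := by
  funext k
  simp [co, Matrix.single_apply, Pi.single_apply, ite_and, eq_comm (a := k)]

/-- `A` is supported in the set `U` of positions. -/
def SuppIn (A : Matrix (Fin n) (Fin n) ℕ) (U : Set (Fin n × Fin n)) : Prop :=
  ∀ i j, A i j ≠ 0 → (i, j) ∈ U

theorem suppIn_add {A B : Matrix (Fin n) (Fin n) ℕ} {U : Set (Fin n × Fin n)} :
    SuppIn (A + B) U ↔ SuppIn A U ∧ SuppIn B U := by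
  simp only [SuppIn, Matrix.add_apply]
  constructor
  · intro h
    exact ⟨fun i j hij => h i j (by omega), fun i j hij => h i j (by omega)⟩
  · rintro ⟨h, h'⟩ i j hij
    by_cases h0 : A i j = 0
    · exact h' i j (by omega)
    · exact h i j h0

/-- The matrices that occur in the straightening of a monomial of content `A`, below the leading
term. -/
structure Below (B A : Matrix (Fin n) (Fin n) ℕ) : Prop where
  lex : LexLT B A
  ro_eq : ro B = ro A
  co_eq : co B = co A
  upper : ∀ U : Set (Fin n × Fin n), IsUpperSet U → SuppIn A U → SuppIn B U
  lower : ∀ U : Set (Fin n × Fin n), IsLowerSet U → SuppIn A U → SuppIn B U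

theorem Below.trans {A B C : Matrix (Fin n) (Fin n) ℕ} (h : Below C B) (h' : Below B A) :
    Below C A where
  lex := h.lex.trans h'.lex
  ro_eq := h.ro_eq.trans h'.ro_eq
  co_eq := h.co_eq.trans h'.co_eq
  upper U hU hA := h.upper U hU (h'.upper U hU hA)
  lower U hU hA := h.lower U hU (h'.lower U hU hA)

theorem Below.add_left {A B : Matrix (Fin n) (Fin n) ℕ} (h : Below B A)
    (C : Matrix (Fin n) (Fin n) ℕ) : Below (C + B) (C + A) where
  lex := h.lex.add_left C
  ro_eq := by rw [ro_add, ro_add, h.ro_eq]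
  co_eq := by rw [co_add, co_add, h.co_eq]
  upper U hU hA := suppIn_add.mpr
    ⟨(suppIn_add.mp hA).1, h.upper U hU (suppIn_add.mp hA).2⟩
  lower U hU hA := suppIn_add.mpr
    ⟨(suppIn_add.mp hA).1, h.lower U hU (suppIn_add.mp hA).2⟩

end Order

/-! ### Words in the generators -/

section Words

variable {n : ℕ}

theorem Oq_sub_smul (c d : K) (x : Oq n) : (c - d) • x = c • x - d • x := sub_smul c d x

/-- The product of the generators along a word. -/
def Zword (w : List (Fin n × Fin n)) : Oq n := (w.map fun p => Zgen p.1 p.2).prod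

/-- The content of a word. -/
def content (w : List (Fin n × Fin n)) : Matrix (Fin n) (Fin n) ℕ := fun i j => w.count (i, j)

theorem Zword_cons (p : Fin n × Fin n) (w : List (Fin n × Fin n)) :
    Zword (p :: w) = Zgen p.1 p.2 * Zword w := by simp [Zword]

theorem content_cons (p : Fin n × Fin n) (w : List (Fin n × Fin n)) :
    content (p :: w) = Matrix.single p.1 p.2 1 + content w := by
  ext i j
  simp [content, List.count_cons, Matrix.single_apply, Prod.ext_iff, add_comm]

theorem content_nil : content ([] : List (Fin n × Fin n)) = 0 := by
  ext i j; simp [content]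

theorem content_perm {w w' : List (Fin n × Fin n)} (h : w.Perm w') : content w = content w' := by
  ext i j; exact h.count_eq _

theorem perm_of_content_eq {w w' : List (Fin n × Fin n)} (h : content w = content w') :
    w.Perm w' :=
  List.perm_iff_count.mpr fun p => congrFun (congrFun h p.1) p.2

/-- `Z_p Z_r` and `q ^ (2 * skew p r) Z_r Z_p` differ by a multiple of the exchanged monomial. -/
def skew (p r : Fin n × Fin n) : ℤ :=
  (if p.1 = r.1 then (if p.2 < r.2 then 1 else 0) - (if r.2 < p.2 then 1 else 0) else 0) +
    (if p.2 = r.2 then (if p.1 < r.1 then 1 else 0) - (if r.1 < p.1 then 1 else 0) else 0)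

theorem skew_swap (p r : Fin n × Fin n) : skew r p = -skew p r := by
  simp only [skew, eq_comm (a := r.1), eq_comm (a := r.2)]
  split_ifs <;> ring

/-- The exponent that normalizes the product along a word. -/
def wordExp : List (Fin n × Fin n) → ℤ
  | [] => 0
  | p :: w => (w.map (skew p)).sum + wordExp w

/-- The span over `ℤ[q, q⁻¹]` of the products along words of content below `A`. -/
def lowerWords (A : Matrix (Fin n) (Fin n) ℕ) : AddSubgroup (Oq n) :=
  AddSubgroup.closure {x | ∃ (k : ℤ) (w : List (Fin n × Fin n)),
    Below (content w) A ∧ x = q ^ k • Zword w}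

theorem smul_mem_lowerWords {A : Matrix (Fin n) (Fin n) ℕ} {x : Oq n} (hx : x ∈ lowerWords A)
    (k : ℤ) : q ^ k • x ∈ lowerWords A := by
  induction hx using AddSubgroup.closure_induction with
  | mem x hx =>
    obtain ⟨l, w, hw, rfl⟩ := hx
    refine AddSubgroup.subset_closure ⟨k + l, w, hw, ?_⟩
    rw [smul_smul, zpow_add₀ q_ne_zero]
  | zero => simp [zero_mem]
  | add x y _ _ hx hy => rw [smul_add]; exact add_mem hx hy
  | neg x _ hx => rw [smul_neg]; exact neg_mem hx

theorem Zgen_mul_mem_lowerWords {A : Matrix (Fin n) (Fin n) ℕ} {x : Oq n}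
    (hx : x ∈ lowerWords A) (p : Fin n × Fin n) :
    Zgen p.1 p.2 * x ∈ lowerWords (Matrix.single p.1 p.2 1 + A) := by
  induction hx using AddSubgroup.closure_induction with
  | mem x hx =>
    obtain ⟨l, w, hw, rfl⟩ := hx
    refine AddSubgroup.subset_closure ⟨l, p :: w, ?_, ?_⟩
    · rw [content_cons]; exact hw.add_left _
    · rw [Zword_cons, mul_smul_comm]
  | zero => simp [zero_mem]
  | add x y _ _ hx hy => rw [mul_add]; exact add_mem hx hy
  | neg x _ hx => exact (mul_neg (Zgen p.1 p.2) x : _) ▸ neg_mem hx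

/-- The new positions $(i,t)$ and $(s,j)$ lie between $(i,j)$ and $(s,t)$ in the product order:
upper sets inherit them from $(i,j)$, lower sets from $(s,t)$. -/
theorem below_exchange {i j s t : Fin n} (h₁ : i < s) (h₂ : j < t) :
    Below (Matrix.single i t 1 + Matrix.single s j 1)
      (Matrix.single i j 1 + Matrix.single s t 1) := by
  have hs (a b : Fin n) (U : Set (Fin n × Fin n)) :
      SuppIn (Matrix.single a b 1) U ↔ (a, b) ∈ U := by
    simp only [SuppIn, Matrix.single_apply]
    constructor
    · intro h; exact h a b (by simp)
    · intro h k l hkl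
      have : a = k ∧ b = l := by by_contra h'; simp [h'] at hkl
      rwa [← this.1, ← this.2]
  refine ⟨⟨i, j, fun k l hkl => ?_, ?_⟩, ?_, ?_, fun U hU h => ?_, fun U hU h => ?_⟩
  · simp only [Matrix.add_apply, Matrix.single_apply]
    rw [if_neg (by omega), if_neg (by omega), if_neg (by omega), if_neg (by omega)]
  · simp [h₁.ne', h₂.ne']
  · simp only [ro_add, ro_single]
  · simp only [co_add, co_single, add_comm]
  · rw [suppIn_add, hs, hs] at h ⊢
    exact ⟨hU (Prod.mk_le_mk.mpr ⟨le_rfl, h₂.le⟩) h.1, hU (Prod.mk_le_mk.mpr ⟨h₁.le, le_rfl⟩) h.1⟩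
  · rw [suppIn_add, hs, hs] at h ⊢
    exact ⟨hU (Prod.mk_le_mk.mpr ⟨h₁.le, le_rfl⟩) h.2, hU (Prod.mk_le_mk.mpr ⟨le_rfl, h₂.le⟩) h.2⟩

theorem swap_cross_mem {i j s t : Fin n} (h₁ : i < s) (h₂ : j < t) (w : List (Fin n × Fin n)) :
    Zgen i j * (Zgen s t * Zword w) - Zgen s t * (Zgen i j * Zword w) ∈
      lowerWords (Matrix.single i j 1 + (Matrix.single s t 1 + content w)) := by
  have e : Zgen i j * (Zgen s t * Zword w) - Zgen s t * (Zgen i j * Zword w) =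
      q ^ (2 : ℤ) • Zword ((i, t) :: (s, j) :: w) - q ^ (-2 : ℤ) • Zword ((i, t) :: (s, j) :: w) := by
    rw [← Oq_sub_smul, ← mul_assoc, ← mul_assoc, ← sub_mul, Zgen_cross i j s t h₁ h₂,
      add_sub_cancel_left, smul_mul_assoc, Zword_cons, Zword_cons, mul_assoc, zpow_neg]
    norm_cast
  have hb : Below (content ((i, t) :: (s, j) :: w))
      (Matrix.single i j 1 + (Matrix.single s t 1 + content w)) := by
    have := (below_exchange h₁ h₂).add_left (content w)
    rwa [add_comm, add_comm (content w), add_assoc, add_assoc, ← content_cons (s, j),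
      ← content_cons (i, t)] at this
  rw [e]
  exact sub_mem (AddSubgroup.subset_closure ⟨_, _, hb, rfl⟩)
    (AddSubgroup.subset_closure ⟨_, _, hb, rfl⟩)

/-- Splitting the factor $q^{2\,\mathrm{skew}}$ evenly between the two sides makes the rule
symmetric in $p$ and $r$. Only the cross relation leaves a remainder. -/
theorem swap_mem (p r : Fin n × Fin n) (w : List (Fin n × Fin n)) :
    q ^ (-skew p r) • Zword (p :: r :: w) - q ^ skew p r • Zword (r :: p :: w) ∈
      lowerWords (content (p :: r :: w)) := by
  obtain ⟨i, j⟩ := p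
  obtain ⟨s, t⟩ := r
  simp only [Zword_cons, content_cons]
  have hq := q_ne_zero
  have key {a b : Oq n} (h : a = q ^ 2 • b) :
      q ^ (-1 : ℤ) • a - q ^ (1 : ℤ) • b ∈
        lowerWords (Matrix.single i j 1 + (Matrix.single s t 1 + content w)) := by
    have : q ^ (-1 : ℤ) * q ^ 2 = q ^ (1 : ℤ) := by
      rw [← zpow_natCast q 2, ← zpow_add₀ hq]; norm_num
    rw [h, smul_smul, this, sub_self]
    exact zero_mem _
  have key' {a b : Oq n} (h : b = q ^ 2 • a) :
      q ^ (1 : ℤ) • a - q ^ (-1 : ℤ) • b ∈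
        lowerWords (Matrix.single i j 1 + (Matrix.single s t 1 + content w)) := by
    rw [← neg_sub]
    exact neg_mem (key h)
  rcases lt_trichotomy i s with h₁ | rfl | h₁ <;> rcases lt_trichotomy j t with h₂ | rfl | h₂
  · have h : skew (i, j) (s, t) = 0 := by simp [skew, h₁.ne, h₂.ne]
    simpa [h] using swap_cross_mem h₁ h₂ w
  · have h : skew (i, j) (s, j) = 1 := by simp [skew, h₁, h₁.ne, h₁.not_gt]
    rw [h]
    exact key (by rw [← mul_assoc, Zgen_col i s j h₁, smul_mul_assoc, mul_assoc])
  · have h : skew (i, j) (s, t) = 0 := by simp [skew, h₁.ne, h₂.ne']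
    rw [h, ← mul_assoc, ← mul_assoc, Zgen_comm s t i j h₁ h₂]
    simp [zero_mem]
  · have h : skew (i, j) (i, t) = 1 := by simp [skew, h₂, h₂.ne, h₂.not_gt]
    rw [h]
    exact key (by rw [← mul_assoc, Zgen_row i j t h₂, smul_mul_assoc, mul_assoc])
  · have h : skew (i, j) (i, j) = 0 := by simp [skew]
    simp [h, zero_mem]
  · have h : skew (i, j) (i, t) = -1 := by simp [skew, h₂, h₂.ne', h₂.not_gt]
    rw [h, neg_neg]
    exact key' (by rw [← mul_assoc, Zgen_row i t j h₂, smul_mul_assoc, mul_assoc])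
  · have h : skew (i, j) (s, t) = 0 := by simp [skew, h₁.ne', h₂.ne]
    rw [h, ← mul_assoc, ← mul_assoc, Zgen_comm i j s t h₁ h₂]
    simp [zero_mem]
  · have h : skew (i, j) (s, j) = -1 := by simp [skew, h₁, h₁.ne', h₁.not_gt]
    rw [h, neg_neg]
    exact key' (by rw [← mul_assoc, Zgen_col s i j h₁, smul_mul_assoc, mul_assoc])
  · have h : skew (i, j) (s, t) = 0 := by simp [skew, h₁.ne', h₂.ne']
    have := neg_mem (swap_cross_mem h₁ h₂ w)
    rw [neg_sub, add_left_comm] at this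
    simpa [h] using this

/-- Permutations are generated by adjacent swaps, and `wordExp` changes under a swap exactly as
`swap_mem` requires. -/
theorem perm_sub_mem {w w' : List (Fin n × Fin n)} (h : w.Perm w') :
    q ^ (-wordExp w) • Zword w - q ^ (-wordExp w') • Zword w' ∈ lowerWords (content w) := by
  have hq := q_ne_zero
  induction h with
  | nil => simp [zero_mem]
  | @cons p w w' h ih =>
    -- The contribution of the new first letter does not depend on the order of the rest, so both
    -- words are rescaled by the same power of $q$.
    have hs : (w'.map (skew p)).sum = (w.map (skew p)).sum := (h.map _).sum_eq.symm
    have := smul_mem_lowerWords (Zgen_mul_mem_lowerWords ih p) (-(w.map (skew p)).sum)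
    rw [mul_sub, mul_smul_comm, mul_smul_comm, smul_sub, smul_smul, smul_smul, ← zpow_add₀ hq,
      ← zpow_add₀ hq, ← Zword_cons, ← Zword_cons, ← content_cons] at this
    simpa only [wordExp, hs, neg_add] using this
  | swap p r w =>
    have := smul_mem_lowerWords (swap_mem r p w)
      (-((w.map (skew p)).sum + (w.map (skew r)).sum + wordExp w))
    rw [smul_sub, smul_smul, smul_smul, ← zpow_add₀ hq, ← zpow_add₀ hq] at this
    convert this using 4
    · simp only [wordExp, List.map_cons, List.sum_cons]; ring
    · simp only [wordExp, List.map_cons, List.sum_cons, skew_swap r p]; ring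
  | trans h h' ih ih' =>
    rw [← content_perm h] at ih'
    simpa using add_mem ih ih'

theorem wordExp_concat (w : List (Fin n × Fin n)) (p : Fin n × Fin n) :
    wordExp (w ++ [p]) = wordExp w - (w.map (skew p)).sum := by
  induction w with
  | nil => simp [wordExp]
  | cons r w ih =>
    simp only [List.cons_append, wordExp, ih, List.map_append, List.sum_append, List.map_cons,
      List.sum_cons, List.map_nil, List.sum_nil, skew_swap p r]
    ring

theorem wordExp_reverse (w : List (Fin n × Fin n)) : wordExp w.reverse = -wordExp w := by
  induction w with
  | nil => simp [wordExp]
  | cons p w ih =>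
    rw [List.reverse_cons, wordExp_concat, ih, wordExp, ((w.reverse_perm).map _).sum_eq]
    ring

theorem bar_one : bar (1 : Oq n) = 1 := by simp [bar]

theorem bar_Zword (w : List (Fin n × Fin n)) : bar (Zword w) = Zword w.reverse := by
  induction w with
  | nil => simp [Zword, bar_one]
  | cons p w ih =>
    rw [Zword_cons, bar_mul, ih, bar_Zgen]
    simp [Zword]

end Words

/-! ### The exponent of the normalization -/

section Exponent

variable {n : ℕ}

theorem two_mul_sum_lt (x : Fin n → ℕ) :
    2 * ∑ j, ∑ k ∈ Finset.univ.filter (fun k => k < j), x j * x k + ∑ j, x j ^ 2 =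
      (∑ j, x j) ^ 2 := by
  have h1 : ∑ j, ∑ k ∈ Finset.univ.filter (fun k => k < j), x j * x k =
      ∑ j, ∑ k ∈ Finset.univ.filter (fun k => j < k), x j * x k := by
    simp only [Finset.sum_filter]
    rw [Finset.sum_comm]
    simp only [mul_comm]
  have h2 : (∑ j, x j) ^ 2 = ∑ j, (∑ k ∈ Finset.univ.filter (fun k => k < j), x j * x k +
      ∑ k ∈ Finset.univ.filter (fun k => j < k), x j * x k + x j ^ 2) := by
    rw [sq, Finset.sum_mul_sum]
    refine Finset.sum_congr rfl fun j _ => ?_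
    have : x j ^ 2 = ∑ k, if k = j then x j * x k else 0 := by simp [sq]
    rw [this, Finset.sum_filter, Finset.sum_filter, ← Finset.sum_add_distrib,
      ← Finset.sum_add_distrib]
    refine Finset.sum_congr rfl fun k _ => ?_
    rcases lt_trichotomy j k with h | rfl | h
    · simp [h, h.not_gt, h.ne']
    · simp
    · simp [h, h.not_gt, h.ne]
  rw [h2, Finset.sum_add_distrib, Finset.sum_add_distrib, ← h1]
  ring

/-- Completing squares in each row and column leaves, apart from $\sum a_{ij}^2$, only row and
column sums. Polarizing gives `dexp_add`, whose cross term for disjoint supports sees only these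
sums. -/
theorem two_mul_dexp (A : Matrix (Fin n) (Fin n) ℕ) :
    2 * dexp A + 2 * ∑ i, ∑ j, A i j ^ 2 = ∑ i, ro A i ^ 2 + ∑ j, co A j ^ 2 := by
  have h1 := Finset.sum_congr rfl fun (i : Fin n) (_ : i ∈ Finset.univ) =>
    two_mul_sum_lt fun j => A i j
  have h2 := Finset.sum_congr rfl fun (i : Fin n) (_ : i ∈ Finset.univ) =>
    two_mul_sum_lt fun j => A j i
  rw [Finset.sum_add_distrib, ← Finset.mul_sum] at h1 h2
  rw [Finset.sum_comm (f := fun i j => A j i ^ 2)] at h2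
  simp only [ro, co, dexp, ← h1, ← h2]
  ring

theorem dexp_add (A B : Matrix (Fin n) (Fin n) ℕ) :
    dexp (A + B) + 2 * ∑ i, ∑ j, A i j * B i j =
      dexp A + dexp B + (∑ i, ro A i * ro B i + ∑ j, co A j * co B j) := by
  have h := two_mul_dexp (A + B)
  have hA := two_mul_dexp A
  have hB := two_mul_dexp B
  simp only [ro_add, co_add, Matrix.add_apply, Pi.add_apply, add_sq, Finset.sum_add_distrib,
    mul_assoc, ← Finset.mul_sum] at h
  linarith

theorem wordExp_eq_dexp {w : List (Fin n × Fin n)} (h : w.Pairwise fun p r => toLex p ≤ toLex r) :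
    wordExp w = dexp (content w) := by
  induction h with
  | nil => simp [wordExp, content_nil, dexp]
  | @cons p w hp hw ih =>
    -- In a sorted word a later letter contributes $1$ for sharing the row and $1$ for sharing the
    -- column, but $0$ when it equals $p$; hence the correction by $2$.
    have e : (w.map (skew p)).sum = ro (content w) p.1 + co (content w) p.2 -
        2 * content w p.1 p.2 := by
      clear hw ih
      induction w with
      | nil => simp [content_nil, ro, co]
      | cons r w ih =>
        have hr := hp r (by simp)
        rw [List.map_cons, List.sum_cons, ih fun s hs => hp s (by simp [hs]), content_cons, ro_add,
          co_add, ro_single, co_single]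
        simp only [Pi.add_apply, Matrix.add_apply, Pi.single_apply, Matrix.single_apply]
        rw [Prod.Lex.le_iff] at hr
        simp only [ofLex_toLex] at hr
        have : skew p r = (if p.1 = r.1 then 1 else 0) + (if p.2 = r.2 then 1 else 0) -
            2 * (if r.1 = p.1 ∧ r.2 = p.2 then 1 else 0) := by
          simp only [skew]
          split_ifs <;> omega
        rw [this]
        push_cast
        ring
    have h1 := dexp_add (Matrix.single p.1 p.2 1) (content w)
    have h2 : dexp (Matrix.single p.1 p.2 1 : Matrix (Fin n) (Fin n) ℕ) = 0 := by
      have := two_mul_dexp (Matrix.single p.1 p.2 1 : Matrix (Fin n) (Fin n) ℕ)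
      rw [ro_single, co_single] at this
      simp [Matrix.single_apply, Pi.single_apply, ite_and] at this
      omega
    rw [ro_single, co_single, h2] at h1
    simp only [Matrix.single_apply, Pi.single_apply, ite_and, ite_mul, one_mul, zero_mul,
      Finset.sum_ite_eq', Finset.mem_univ, if_true] at h1
    simp only [Finset.sum_ite_irrel, Finset.sum_const_zero, Finset.sum_ite_eq, Finset.mem_univ,
      if_true] at h1
    rw [wordExp, ih, e, content_cons]
    omega

end Exponent

/-! ### Straightening -/

section Straightening

variable {n : ℕ}

/-- The ordered word of content `A`. -/
def sortedWord (A : Matrix (Fin n) (Fin n) ℕ) : List (Fin n × Fin n) :=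
  (List.ofFn fun i => (List.ofFn fun j => List.replicate (A i j) (i, j)).flatten).flatten

theorem Zword_sortedWord (A : Matrix (Fin n) (Fin n) ℕ) : Zword (sortedWord A) = Zpow A := by
  simp only [Zword, sortedWord, Zpow, List.map_flatten, List.map_ofFn, List.prod_flatten]
  congr 2
  funext i
  simp only [Function.comp, List.map_flatten, List.map_ofFn, List.prod_flatten]
  congr 2
  funext j
  simp

theorem content_sortedWord (A : Matrix (Fin n) (Fin n) ℕ) : content (sortedWord A) = A := by
  ext i j
  simp only [content, sortedWord, List.count_flatten, List.map_ofFn, List.sum_ofFn]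
  rw [Finset.sum_eq_single i]
  · simp only [Function.comp, List.count_flatten, List.map_ofFn, List.sum_ofFn]
    rw [Finset.sum_eq_single j] <;> simp +contextual [List.count_replicate]
  · intro k _ hk
    simp [List.count_flatten, List.sum_ofFn, List.count_replicate, hk, List.map_ofFn, Function.comp]
  · simp

theorem sortedWord_pairwise (A : Matrix (Fin n) (Fin n) ℕ) :
    (sortedWord A).Pairwise fun p r => toLex p ≤ toLex r := by
  rw [sortedWord, List.pairwise_flatten, List.pairwise_ofFn]
  refine ⟨?_, ?_⟩
  · simp only [List.mem_ofFn, forall_exists_index, forall_apply_eq_imp_iff]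
    intro i
    rw [List.pairwise_flatten, List.pairwise_ofFn]
    refine ⟨?_, ?_⟩
    · simp only [List.mem_ofFn, forall_exists_index, forall_apply_eq_imp_iff]
      intro j
      simp [List.pairwise_replicate]
    · intro j k hjk p hp r hr
      rw [List.eq_of_mem_replicate hp, List.eq_of_mem_replicate hr, Prod.Lex.le_iff]
      exact Or.inr ⟨rfl, hjk.le⟩
  · intro i k hik p hp r hr
    simp only [List.mem_flatten, List.mem_ofFn, exists_exists_eq_and] at hp hr
    obtain ⟨j, hp⟩ := hp
    obtain ⟨l, hr⟩ := hr
    rw [List.eq_of_mem_replicate hp, List.eq_of_mem_replicate hr, Prod.Lex.le_iff]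
    exact Or.inl hik

theorem Znorm_eq (A : Matrix (Fin n) (Fin n) ℕ) :
    Znorm A = q ^ (-wordExp (sortedWord A)) • Zword (sortedWord A) := by
  rw [Znorm, wordExp_eq_dexp (sortedWord_pairwise A), content_sortedWord, Zword_sortedWord]

/-- The span over `ℤ[q, q⁻¹]` of the normalized monomials below `A`. -/
def lowerSpan (A : Matrix (Fin n) (Fin n) ℕ) : AddSubgroup (Oq n) :=
  AddSubgroup.closure {x | ∃ (k : ℤ) (B : Matrix (Fin n) (Fin n) ℕ),
    Below B A ∧ x = q ^ k • Znorm B}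

theorem smul_mem_lowerSpan {A : Matrix (Fin n) (Fin n) ℕ} {x : Oq n} (hx : x ∈ lowerSpan A)
    (k : ℤ) : q ^ k • x ∈ lowerSpan A := by
  induction hx using AddSubgroup.closure_induction with
  | mem x hx =>
    obtain ⟨l, w, hw, rfl⟩ := hx
    refine AddSubgroup.subset_closure ⟨k + l, w, hw, ?_⟩
    rw [smul_smul, zpow_add₀ q_ne_zero]
  | zero => simp [zero_mem]
  | add x y _ _ hx hy => rw [smul_add]; exact add_mem hx hy
  | neg x _ hx => rw [smul_neg]; exact neg_mem hx

theorem lowerSpan_mono {A B : Matrix (Fin n) (Fin n) ℕ} (h : Below B A) :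
    lowerSpan B ≤ lowerSpan A :=
  AddSubgroup.closure_mono fun _ ⟨k, C, hC, hx⟩ => ⟨k, C, hC.trans h, hx⟩

theorem Zword_sub_mem_lowerWords (w : List (Fin n × Fin n)) :
    q ^ (-wordExp w) • Zword w - Znorm (content w) ∈ lowerWords (content w) := by
  rw [Znorm_eq]
  exact perm_sub_mem (perm_of_content_eq (content_sortedWord _).symm)

/-- Sorting a word costs words of strictly lower content, which are straightened by induction. -/
theorem lowerWords_le (A : Matrix (Fin n) (Fin n) ℕ) : lowerWords A ≤ lowerSpan A := by
  induction A using lexLT_wf.induction with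
  | _ A ih =>
    rw [lowerWords, AddSubgroup.closure_le]
    rintro _ ⟨k, w, hw, rfl⟩
    have h1 := lowerSpan_mono hw (ih _ hw.lex (Zword_sub_mem_lowerWords w))
    have h2 : Znorm (content w) ∈ lowerSpan A :=
      AddSubgroup.subset_closure ⟨0, _, hw, by simp⟩
    have h3 := smul_mem_lowerSpan (add_mem h1 h2) (k + wordExp w)
    rwa [sub_add_cancel, smul_smul, ← zpow_add₀ q_ne_zero, add_neg_cancel_right] at h3

theorem Zword_sub_mem (w : List (Fin n × Fin n)) :
    q ^ (-wordExp w) • Zword w - Znorm (content w) ∈ lowerSpan (content w) :=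
  lowerWords_le _ (Zword_sub_mem_lowerWords w)

theorem barK_zpow (k : ℤ) : barK (q ^ k) = q ^ (-k) := by
  rw [map_zpow₀, barK_q, inv_zpow, zpow_neg]

theorem bar_Znorm (A : Matrix (Fin n) (Fin n) ℕ) :
    bar (Znorm A) = q ^ wordExp (sortedWord A) • Zword (sortedWord A).reverse := by
  rw [Znorm_eq, bar_smul, barK_zpow, bar_Zword, neg_neg]

theorem bar_bar_Znorm (A : Matrix (Fin n) (Fin n) ℕ) : bar (bar (Znorm A)) = Znorm A := by
  rw [bar_Znorm, bar_smul, barK_zpow, bar_Zword, List.reverse_reverse, Znorm_eq]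

/-- Bar reverses the sorted word and inverts its power of $q$; reversal negates `wordExp`, so the
result is again a normalized word of content $A$. -/
theorem bar_Znorm_sub_mem (A : Matrix (Fin n) (Fin n) ℕ) :
    bar (Znorm A) - Znorm A ∈ lowerSpan A := by
  have h := Zword_sub_mem (sortedWord A).reverse
  rwa [content_perm (List.reverse_perm _), content_sortedWord, wordExp_reverse, neg_neg,
    ← bar_Znorm] at h

end Straightening

/-! ### Laurent polynomials in `q` -/

/-- The value at `q` of an integral polynomial. -/
def evalQ : ℤ[X] →+* K := Polynomial.eval₂RingHom (Int.castRingHom K) q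

theorem evalQ_apply (f : ℤ[X]) : evalQ f = f.eval₂ (Int.castRingHom K) q := rfl

theorem barK_evalQ (f : ℤ[X]) : barK (evalQ f) = f.eval₂ (Int.castRingHom K) q⁻¹ := by
  rw [evalQ_apply, Polynomial.hom_eval₂, barK_q]
  congr 1
  exact Subsingleton.elim _ _

theorem barK_barK_evalQ (f : ℤ[X]) : barK (barK (evalQ f)) = evalQ f := by
  rw [barK_evalQ, Polynomial.hom_eval₂, map_inv₀, barK_q, inv_inv, evalQ_apply]
  congr 1
  exact Subsingleton.elim _ _

theorem evalQ_injective : Function.Injective evalQ := by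
  have h : evalQ = (algebraMap ℚ[X] K).comp (Polynomial.mapRingHom (Int.castRingHom ℚ)) := by
    refine Polynomial.ringHom_ext' (Subsingleton.elim _ _) ?_
    simp [evalQ_apply, q]
  intro f g hfg
  simp only [h, RingHom.comp_apply, Polynomial.coe_mapRingHom] at hfg
  exact Polynomial.map_injective _ Int.cast_injective (RatFunc.algebraMap_injective ℚ hfg)

/-- Positive, zero and negative powers of $q$ are independent. After multiplication by $q^N$ with
$N=\deg g$, the part from $g(q^{-1})$ lives in degrees below $N$ and the rest in degrees at least
$N$. -/
theorem evalQ_add_barK_eq_zero {f g : ℤ[X]} {a : ℤ} (hf : Polynomial.X ∣ f)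
    (hg : Polynomial.X ∣ g) (h : evalQ f + a + barK (evalQ g) = 0) : f = 0 ∧ a = 0 ∧ g = 0 := by
  have hq := q_ne_zero
  set N := g.natDegree
  have hg' : barK (evalQ g) * q ^ N = evalQ g.reverse := by
    let _ : Invertible (q⁻¹ : K) := invertibleOfNonzero (inv_ne_zero hq)
    have h2 := Polynomial.eval₂_reverse_mul_pow (Int.castRingHom K) (q⁻¹) g
    rw [barK_evalQ, ← h2, invOf_eq_inv, inv_inv, mul_assoc, ← mul_pow, inv_mul_cancel₀ hq, one_pow,
      mul_one, evalQ_apply]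
  have key : (f + Polynomial.C a) * Polynomial.X ^ N + g.reverse = 0 := by
    apply evalQ_injective
    rw [map_add, map_mul, map_pow, map_add, ← hg', map_zero]
    have hX : evalQ Polynomial.X = q := Polynomial.eval₂_X _ _
    have hC : evalQ (Polynomial.C a) = a := by simp
    rw [hX, hC, ← add_mul, h, zero_mul]
  have hrev (k : ℕ) : g.reverse.coeff (k + N) = 0 := by
    rcases Nat.eq_zero_or_pos k with rfl | hk
    · rw [zero_add, Polynomial.coeff_reverse, Polynomial.revAt_le le_rfl, Nat.sub_self]
      exact Polynomial.X_dvd_iff.mp hg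
    · refine Polynomial.coeff_eq_zero_of_natDegree_lt ?_
      have := Polynomial.reverse_natDegree_le g
      omega
  have hfa : f + Polynomial.C a = 0 := by
    ext k
    have := congrArg (fun p => Polynomial.coeff p (k + N)) key
    simpa [hrev, Polynomial.coeff_mul_X_pow] using this
  have ha : a = 0 := by
    have := congrArg (fun p => Polynomial.coeff p 0) hfa
    simpa [Polynomial.X_dvd_iff.mp hf] using this
  rw [hfa, zero_mul, zero_add, Polynomial.reverse_eq_zero] at key
  refine ⟨?_, ha, key⟩
  simpa [ha] using hfa

/-- The ring `ℤ[q, q⁻¹]`, as an additive subgroup of `ℚ(q)`. -/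
def laurent : AddSubgroup K := AddSubgroup.closure (Set.range fun k : ℤ => q ^ k)

theorem zpow_mem_laurent (k : ℤ) : q ^ k ∈ laurent := AddSubgroup.subset_closure ⟨k, rfl⟩

theorem mul_mem_laurent {c d : K} (hc : c ∈ laurent) (hd : d ∈ laurent) : c * d ∈ laurent := by
  induction hc using AddSubgroup.closure_induction with
  | mem x hx =>
    obtain ⟨k, rfl⟩ := hx
    dsimp only
    induction hd using AddSubgroup.closure_induction with
    | mem y hy =>
      obtain ⟨l, rfl⟩ := hy
      dsimp only
      rw [← zpow_add₀ q_ne_zero]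
      exact zpow_mem_laurent _
    | zero => simp [zero_mem]
    | add x y _ _ hx hy => rw [mul_add]; exact add_mem hx hy
    | neg x _ hx => rw [mul_neg]; exact neg_mem hx
  | zero => simp [zero_mem]
  | add x y _ _ hx hy => rw [add_mul]; exact add_mem hx hy
  | neg x _ hx => rw [neg_mul]; exact neg_mem hx

theorem evalQ_monomial (k : ℕ) (a : ℤ) : evalQ (Polynomial.monomial k a) = a • q ^ (k : ℤ) := by
  simp [evalQ_apply, Polynomial.eval₂_monomial]

theorem barK_evalQ_mem_laurent (f : ℤ[X]) : barK (evalQ f) ∈ laurent := by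
  induction f using Polynomial.induction_on' with
  | add f g hf hg => rw [map_add, map_add]; exact add_mem hf hg
  | monomial k a =>
    rw [evalQ_monomial, map_zsmul, barK_zpow]
    exact zsmul_mem (zpow_mem_laurent _) _

theorem exists_of_mem_laurent {c : K} (hc : c ∈ laurent) :
    ∃ (f g : ℤ[X]) (a : ℤ), Polynomial.X ∣ f ∧ Polynomial.X ∣ g ∧
      c = evalQ f + a + barK (evalQ g) := by
  induction hc using AddSubgroup.closure_induction with
  | mem x hx =>
    obtain ⟨k, rfl⟩ := hx
    have hX (m : ℕ) : evalQ (Polynomial.X ^ (m + 1)) = q ^ ((m : ℤ) + 1) := by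
      rw [← Polynomial.monomial_one_right_eq_X_pow, evalQ_monomial]; simp
    rcases k with (_ | k) | k
    · exact ⟨0, 0, 1, by simp⟩
    · refine ⟨Polynomial.X ^ (k + 1), 0, 0, dvd_pow_self _ (by omega), dvd_zero _, ?_⟩
      rw [hX]; simp
    · refine ⟨0, Polynomial.X ^ (k + 1), 0, dvd_zero _, dvd_pow_self _ (by omega), ?_⟩
      rw [hX, barK_zpow, Int.negSucc_eq]; simp
  | zero => exact ⟨0, 0, 0, by simp⟩
  | add x y _ _ hx hy =>
    obtain ⟨f, g, a, hf, hg, rfl⟩ := hx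
    obtain ⟨f', g', a', hf', hg', rfl⟩ := hy
    refine ⟨f + f', g + g', a + a', dvd_add hf hf', dvd_add hg hg', ?_⟩
    push_cast [map_add]
    ring
  | neg x _ hx =>
    obtain ⟨f, g, a, hf, hg, rfl⟩ := hx
    refine ⟨-f, -g, -a, (dvd_neg).mpr hf, (dvd_neg).mpr hg, ?_⟩
    push_cast [map_neg]
    ring

theorem exists_sub_barK {c : K} (hc : c ∈ laurent) (h : barK c = -c) :
    ∃ f : ℤ[X], Polynomial.X ∣ f ∧ c = evalQ f - barK (evalQ f) := by
  obtain ⟨f, g, a, hf, hg, rfl⟩ := exists_of_mem_laurent hc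
  have h' : evalQ (f + g) + ((a + a : ℤ) : K) + barK (evalQ (f + g)) = 0 := by
    rw [map_add, map_add, barK_barK_evalQ, map_intCast] at h
    push_cast [map_add]
    linear_combination h
  obtain ⟨h1, h2, -⟩ := evalQ_add_barK_eq_zero (dvd_add hf hg) (dvd_add hf hg) h'
  refine ⟨f, hf, ?_⟩
  obtain rfl : a = 0 := by omega
  rw [eq_neg_of_add_eq_zero_right h1]
  simp [sub_eq_add_neg]

/-! ### Coordinates -/

section Coordinates

variable {n : ℕ}

theorem lowerSpan_le_span (A : Matrix (Fin n) (Fin n) ℕ) {x : Oq n} (hx : x ∈ lowerSpan A) :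
    x ∈ Submodule.span K (Set.range (Znorm (n := n))) := by
  induction hx using AddSubgroup.closure_induction with
  | mem x hx =>
    obtain ⟨k, B, -, rfl⟩ := hx
    exact Submodule.smul_mem _ _ (Submodule.subset_span ⟨B, rfl⟩)
  | zero => exact zero_mem _
  | add x y _ _ hx hy => exact add_mem hx hy
  | neg x _ hx => exact neg_mem hx

theorem Zword_mem_span (w : List (Fin n × Fin n)) :
    Zword w ∈ Submodule.span K (Set.range (Znorm (n := n))) := by
  have h := add_mem (lowerSpan_le_span _ (Zword_sub_mem w))
    (Submodule.subset_span ⟨content w, rfl⟩)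
  rw [sub_add_cancel] at h
  have := Submodule.smul_mem _ (q ^ wordExp w) h
  rwa [smul_smul, ← zpow_add₀ q_ne_zero, add_neg_cancel, zpow_zero, one_smul] at this

theorem span_Znorm : Submodule.span K (Set.range (Znorm (n := n))) = ⊤ := by
  have hw : Submodule.span K (Set.range (Zword (n := n))) ≤
      Submodule.span K (Set.range (Znorm (n := n))) := by
    rw [Submodule.span_le]
    rintro _ ⟨w, rfl⟩
    exact Zword_mem_span w
  rw [eq_top_iff]
  rintro x -
  apply hw
  obtain ⟨y, rfl⟩ := RingQuot.mkAlgHom_surjective K (Rel n) x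
  -- The span of the words is stable under left multiplication and contains $1$, so it is
  -- everything.
  have key : ∀ z ∈ Submodule.span K (Set.range (Zword (n := n))),
      RingQuot.mkAlgHom K (Rel n) y * z ∈ Submodule.span K (Set.range (Zword (n := n))) := by
    induction y using FreeAlgebra.induction with
    | grade0 c =>
      intro z hz
      rw [AlgHom.commutes, ← Algebra.smul_def]
      exact Submodule.smul_mem _ _ hz
    | grade1 p =>
      intro z hz
      induction hz using Submodule.span_induction with
      | mem z hz =>
        obtain ⟨w, rfl⟩ := hz
        exact Submodule.subset_span ⟨p :: w, Zword_cons p w⟩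
      | zero => rw [mul_zero]; exact zero_mem _
      | add z z' _ _ hz hz' => rw [mul_add]; exact add_mem hz hz'
      | smul c z _ hz => rw [mul_smul_comm]; exact Submodule.smul_mem _ _ hz
    | mul a b ha hb => intro z hz; rw [map_mul, mul_assoc]; exact ha _ (hb z hz)
    | add a b ha hb => intro z hz; rw [map_add, add_mul]; exact add_mem (ha z hz) (hb z hz)
  simpa using key 1 (Submodule.subset_span ⟨[], by simp [Zword]⟩)

/-- The basis of normalized ordered monomials. -/
def ZBasis (n : ℕ) : Module.Basis (Matrix (Fin n) (Fin n) ℕ) K (Oq n) :=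
  Module.Basis.mk (linearIndependent_Znorm n) span_Znorm.ge

theorem ZBasis_apply (A : Matrix (Fin n) (Fin n) ℕ) : ZBasis n A = Znorm A :=
  Module.Basis.mk_apply _ _ A

/-- The coordinate at `Z(B)`. -/
def coord (B : Matrix (Fin n) (Fin n) ℕ) : Oq n →ₗ[K] K := (ZBasis n).coord B

theorem coord_Znorm (A B : Matrix (Fin n) (Fin n) ℕ) :
    coord B (Znorm A) = if A = B then 1 else 0 := by
  rw [← ZBasis_apply, coord, Module.Basis.coord_apply, Module.Basis.repr_self,
    Finsupp.single_apply]

theorem coord_lowerSpan {A : Matrix (Fin n) (Fin n) ℕ} {x : Oq n} (hx : x ∈ lowerSpan A)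
    (B : Matrix (Fin n) (Fin n) ℕ) : coord B x ∈ laurent ∧ (coord B x ≠ 0 → Below B A) := by
  induction hx using AddSubgroup.closure_induction with
  | mem x hx =>
    obtain ⟨k, C, hC, rfl⟩ := hx
    rw [map_smul, coord_Znorm]
    split_ifs with h
    · subst h
      exact ⟨by simpa using zpow_mem_laurent k, fun _ => hC⟩
    · simp [zero_mem]
  | zero => simp [zero_mem]
  | add x y _ _ hx hy =>
    rw [map_add]
    refine ⟨add_mem hx.1 hy.1, fun h => ?_⟩
    by_cases h0 : coord B x = 0
    · exact hy.2 (by simpa [h0] using h)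
    · exact hx.2 h0
  | neg x _ hx =>
    rw [map_neg]
    exact ⟨neg_mem hx.1, fun h => hx.2 (neg_ne_zero.mp h)⟩

/-- `bar` as an additive map. -/
def barAdd (n : ℕ) : Oq n →+ Oq n where
  toFun := bar
  map_zero' := by simp [bar]
  map_add' := bar_add

theorem bar_sub (x y : Oq n) : bar (x - y) = bar x - bar y := map_sub (barAdd n) x y

/-- Bar is semilinear and unitriangular, so no lower term can contribute to the top coordinate. -/
theorem coord_bar_of_top {x : Oq n} {B : Matrix (Fin n) (Fin n) ℕ}
    (h : ∀ C, coord C x ≠ 0 → C = B ∨ LexLT C B) : coord B (bar x) = barK (coord B x) := by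
  have hx : bar x = ∑ C ∈ ((ZBasis n).repr x).support, barK (coord C x) • bar (Znorm C) := by
    conv_lhs => rw [← (ZBasis n).linearCombination_repr x, Finsupp.linearCombination_apply,
      Finsupp.sum]
    rw [← show barAdd n _ = bar _ from rfl, map_sum]
    refine Finset.sum_congr rfl fun C _ => ?_
    rw [ZBasis_apply]
    exact bar_smul _ _
  have hc (C) : coord B (bar (Znorm C)) =
      (if C = B then 1 else 0) + coord B (bar (Znorm C) - Znorm C) := by
    rw [map_sub, coord_Znorm]; ring
  rw [hx, map_sum, Finset.sum_eq_single B]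
  · rw [map_smul, hc, if_pos rfl]
    have : coord B (bar (Znorm B) - Znorm B) = 0 := by
      by_contra h0
      exact ((coord_lowerSpan (bar_Znorm_sub_mem B) B).2 h0).lex.ne rfl
    simp [this]
  · intro C hC hCB
    have hC' : coord C x ≠ 0 := by simpa [coord] using hC
    rw [map_smul, hc, if_neg hCB]
    have : coord B (bar (Znorm C) - Znorm C) = 0 := by
      by_contra h0
      have h1 := ((coord_lowerSpan (bar_Znorm_sub_mem C) B).2 h0).lex
      exact ((h C hC').resolve_left hCB |>.trans h1).ne rfl
    simp [this]
  · intro hB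
    have : coord B x = 0 := by simpa [coord] using hB
    simp [this]

theorem exists_top {x : Oq n} (hx : x ≠ 0) :
    ∃ B, coord B x ≠ 0 ∧ ∀ C, coord C x ≠ 0 → C = B ∨ LexLT C B := by
  have hne : ((ZBasis n).repr x).support.Nonempty := by
    rw [Finsupp.support_nonempty_iff]
    simpa using hx
  obtain ⟨B, hB, hmax⟩ := Finset.exists_max_image _ lexEmb hne
  refine ⟨B, by simpa [coord] using hB, fun C hC => ?_⟩
  rcases (hmax C (by simpa [coord] using hC)).eq_or_lt with h | h
  · exact Or.inl (lexEmb_injective h)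
  · exact Or.inr (lexLT_iff.mpr h)

end Coordinates

/-! ### The dual canonical basis -/

section DualCanonical

variable {n : ℕ}

/-- The top coefficient would be a bar-invariant element of $q\mathbb Z[q]$, hence zero. This gives
uniqueness of $b(A)$. -/
theorem eq_zero_of_bar_eq {x : Oq n} (hbar : bar x = x)
    (hx : ∀ B, ∃ f : ℤ[X], Polynomial.X ∣ f ∧ coord B x = evalQ f) : x = 0 := by
  by_contra h0
  obtain ⟨B, hB, htop⟩ := exists_top h0
  obtain ⟨f, hf, hfB⟩ := hx B
  have h := coord_bar_of_top htop
  rw [hbar, hfB] at h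
  have h' : evalQ f + ((0 : ℤ) : K) + barK (evalQ (-f)) = 0 := by
    rw [map_neg, map_neg, ← h]; simp
  rw [hfB, (evalQ_add_barK_eq_zero hf ((dvd_neg).mpr hf) h').1, map_zero] at hB
  exact hB rfl

/-- The span over `q ℤ[q]` of the normalized monomials below `A`. -/
def tailSpan (A : Matrix (Fin n) (Fin n) ℕ) : AddSubgroup (Oq n) :=
  AddSubgroup.closure {x | ∃ (f : ℤ[X]) (B : Matrix (Fin n) (Fin n) ℕ),
    Polynomial.X ∣ f ∧ Below B A ∧ x = evalQ f • Znorm B}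

theorem exists_of_mem_tailSpan {A : Matrix (Fin n) (Fin n) ℕ} {x : Oq n} (hx : x ∈ tailSpan A) :
    ∃ h : Matrix (Fin n) (Fin n) ℕ →₀ ℤ[X],
      (∀ B ∈ h.support, Below B A ∧ Polynomial.X ∣ h B) ∧
        x = h.sum fun B p => evalQ p • Znorm B := by
  have hs (h : Matrix (Fin n) (Fin n) ℕ →₀ ℤ[X]) (h' : Matrix (Fin n) (Fin n) ℕ →₀ ℤ[X]) :
      ((h + h').sum fun B p => evalQ p • (Znorm B : Oq n)) =
        (h.sum fun B p => evalQ p • Znorm B) + h'.sum fun B p => evalQ p • Znorm B :=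
    Finsupp.sum_add_index' (by simp) (by simp [add_smul])
  induction hx using AddSubgroup.closure_induction with
  | mem x hx =>
    obtain ⟨f, B, hf, hB, rfl⟩ := hx
    refine ⟨Finsupp.single B f, fun C hC => ?_, ?_⟩
    · obtain rfl : C = B := by
        by_contra h; simp [Ne.symm h] at hC
      simpa using ⟨hB, hf⟩
    · rw [Finsupp.sum_single_index (by simp)]
  | zero => exact ⟨0, by simp⟩
  | add x y _ _ hx hy =>
    obtain ⟨h, hh, rfl⟩ := hx
    obtain ⟨h', hh', rfl⟩ := hy
    refine ⟨h + h', fun B hB => ?_, (hs h h').symm⟩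
    rw [Finsupp.mem_support_iff, Finsupp.add_apply] at hB
    rw [Finsupp.add_apply]
    by_cases h0 : h B = 0
    · rw [h0, zero_add] at hB ⊢
      exact hh' B (by simpa using hB)
    · refine ⟨(hh B (by simpa using h0)).1, dvd_add (hh B (by simpa using h0)).2 ?_⟩
      by_cases h0' : h' B = 0
      · simp [h0']
      · exact (hh' B (by simpa using h0')).2
  | neg x _ hx =>
    obtain ⟨h, hh, rfl⟩ := hx
    refine ⟨-h, fun B hB => ?_, ?_⟩
    · rw [Finsupp.support_neg] at hB
      simpa using hh B hB
    · rw [neg_eq_iff_add_eq_zero, ← hs, add_neg_cancel]; simp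

theorem isDualCanonical_of_mem {A : Matrix (Fin n) (Fin n) ℕ} {x : Oq n} (hbar : bar x = x)
    (hx : x - Znorm A ∈ tailSpan A) : IsDualCanonical A x := by
  obtain ⟨h, hh, hx⟩ := exists_of_mem_tailSpan hx
  refine ⟨hbar, h, fun B hB => ?_, ?_⟩
  · obtain ⟨h1, h2⟩ := hh B hB
    exact ⟨h1.lex, h1.ro_eq, h1.co_eq, h2⟩
  · rw [sub_eq_iff_eq_add'] at hx
    exact hx

theorem IsDualCanonical.eq {A : Matrix (Fin n) (Fin n) ℕ} {x y : Oq n} (hx : IsDualCanonical A x)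
    (hy : IsDualCanonical A y) : x = y := by
  obtain ⟨hx, h, hh, hxh⟩ := hx
  obtain ⟨hy, h', hh', hyh⟩ := hy
  have hc (h : Matrix (Fin n) (Fin n) ℕ →₀ ℤ[X]) (B : Matrix (Fin n) (Fin n) ℕ) :
      coord B (h.sum fun B p => p.eval₂ (Int.castRingHom K) q • Znorm B) = evalQ (h B) := by
    rw [Finsupp.sum, map_sum, Finset.sum_eq_single B]
    · rw [map_smul, coord_Znorm, if_pos rfl, smul_eq_mul, mul_one, evalQ_apply]
    · intro C _ hCB
      rw [map_smul, coord_Znorm, if_neg hCB, smul_zero]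
    · intro hB
      rw [Finsupp.notMem_support_iff] at hB
      simp [hB]
  have hd {h : Matrix (Fin n) (Fin n) ℕ →₀ ℤ[X]} (hh : ∀ B ∈ h.support, LexLT B A ∧ ro B = ro A ∧
      co B = co A ∧ Polynomial.X ∣ h B) (B) : Polynomial.X ∣ h B := by
    by_cases h0 : h B = 0
    · simp [h0]
    · exact (hh B (by simpa using h0)).2.2.2
  refine sub_eq_zero.mp (eq_zero_of_bar_eq (by rw [bar_sub, hx, hy]) fun B =>
    ⟨h B - h' B, dvd_sub (hd hh B) (hd hh' B), ?_⟩)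
  rw [hxh, hyh, add_sub_add_left_eq_sub, map_sub, hc, hc, map_sub]

/-- Lusztig's lemma. The top coefficient of $y$ is anti-invariant, hence $f-\bar f$ with $f\in
q\mathbb Z[q]$; subtracting $u-\bar u$ for $u=f\,Z(T)$ removes the top term and keeps every
hypothesis. -/
theorem exists_sub_bar {A : Matrix (Fin n) (Fin n) ℕ} {y : Oq n} (hy : bar y = -y)
    (hc : ∀ B, coord B y ∈ laurent ∧ (coord B y ≠ 0 → Below B A)) :
    ∃ x ∈ tailSpan A, y = x - bar x := by
  have key : ∀ T, ∀ y : Oq n, bar y = -y →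
      (∀ B, coord B y ∈ laurent ∧ (coord B y ≠ 0 → Below B A)) → coord T y ≠ 0 →
      (∀ C, coord C y ≠ 0 → C = T ∨ LexLT C T) → ∃ x ∈ tailSpan A, y = x - bar x := by
    intro T
    induction T using lexLT_wf.induction with
    | _ T ih =>
    intro y hy hc hT htop
    have h1 := coord_bar_of_top htop
    rw [hy, map_neg] at h1
    obtain ⟨f, hf, hfT⟩ := exists_sub_barK (hc T).1 h1.symm
    have hu : evalQ f • Znorm T ∈ tailSpan A :=
      AddSubgroup.subset_closure ⟨f, T, hf, (hc T).2 hT, rfl⟩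
    set u := evalQ f • (Znorm T : Oq n) with hu_def
    have hbu : bar (bar u) = u := by
      rw [hu_def, bar_smul, bar_smul, barK_barK_evalQ, bar_bar_Znorm]
    have hl := coord_lowerSpan (bar_Znorm_sub_mem T)
    have hy' (C) : coord C (y - (u - bar u)) = coord C y - (if T = C then coord T y else 0) +
        barK (evalQ f) * coord C (bar (Znorm T) - Znorm T) := by
      rw [map_sub, map_sub, map_sub, hu_def, bar_smul, map_smul, map_smul, coord_Znorm, hfT]
      split_ifs <;> simp only [smul_eq_mul] <;> ring
    have hbar : bar (y - (u - bar u)) = -(y - (u - bar u)) := by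
      rw [bar_sub, bar_sub, hy, hbu]; abel
    have hTT : coord T (y - (u - bar u)) = 0 := by
      have : coord T (bar (Znorm T) - Znorm T) = 0 := by
        by_contra h0
        exact ((hl T).2 h0).lex.ne rfl
      rw [hy', this]; simp
    have hne (C) (hC : coord C (y - (u - bar u)) ≠ 0) : Below C A ∧ LexLT C T := by
      have hCT : T ≠ C := by rintro rfl; exact hC hTT
      rw [hy', if_neg hCT, sub_zero] at hC
      by_cases h0 : coord C y = 0
      · rw [h0, zero_add] at hC
        have := (hl C).2 (right_ne_zero_of_mul hC)
        exact ⟨this.trans ((hc T).2 hT), this.lex⟩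
      · exact ⟨(hc C).2 h0, (htop C h0).resolve_left (Ne.symm hCT)⟩
    have hc' (C) : coord C (y - (u - bar u)) ∈ laurent ∧
        (coord C (y - (u - bar u)) ≠ 0 → Below C A) := by
      refine ⟨?_, fun h => (hne C h).1⟩
      rw [hy']
      refine add_mem (sub_mem (hc C).1 ?_) (mul_mem_laurent (barK_evalQ_mem_laurent f) (hl C).1)
      split_ifs
      · exact (hc T).1
      · exact zero_mem _
    by_cases h0 : y - (u - bar u) = 0
    · exact ⟨u, hu, sub_eq_zero.mp h0⟩
    · obtain ⟨T', hT', htop'⟩ := exists_top h0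
      obtain ⟨x, hx, hxy⟩ := ih T' (hne T' hT').2 _ hbar hc' hT' htop'
      refine ⟨x + u, add_mem hx hu, ?_⟩
      rw [bar_add, add_sub_add_comm, ← hxy, sub_add_cancel]
  by_cases h0 : y = 0
  · exact ⟨0, zero_mem _, by rw [h0]; simp [bar]⟩
  · obtain ⟨T, hT, htop⟩ := exists_top h0
    exact key T y hy hc hT htop

theorem exists_isDualCanonical (A : Matrix (Fin n) (Fin n) ℕ) :
    ∃ x : Oq n, bar x = x ∧ x - Znorm A ∈ tailSpan A := by
  -- From $\overline{Z(A)}-Z(A)=x-\bar x$ it follows that $Z(A)+x$ is bar-invariant.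
  obtain ⟨x, hx, h⟩ := exists_sub_bar (y := bar (Znorm A) - Znorm A)
    (by rw [bar_sub, bar_bar_Znorm, neg_sub]) (coord_lowerSpan (bar_Znorm_sub_mem A))
  refine ⟨Znorm A + x, ?_, by rwa [add_sub_cancel_left]⟩
  rw [sub_eq_sub_iff_add_eq_add] at h
  rw [bar_add, h, add_comm]

theorem isDualCanonical_b (A : Matrix (Fin n) (Fin n) ℕ) : IsDualCanonical A (b A) := by
  obtain ⟨x, hx, h⟩ := exists_isDualCanonical A
  exact Classical.epsilon_spec ⟨x, isDualCanonical_of_mem hx h⟩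

theorem bar_b (A : Matrix (Fin n) (Fin n) ℕ) : bar (b A) = b A := (isDualCanonical_b A).1

/-- The definition of $b(A)$ does not mention supports in upper and lower sets. The constructed
element has that extra control, and uniqueness carries it over to `b A`. -/
theorem b_sub_mem (A : Matrix (Fin n) (Fin n) ℕ) : b A - Znorm A ∈ tailSpan A := by
  obtain ⟨x, hx, h⟩ := exists_isDualCanonical A
  rwa [(isDualCanonical_b A).eq (isDualCanonical_of_mem hx h)]

theorem coord_tailSpan {A : Matrix (Fin n) (Fin n) ℕ} {x : Oq n} (hx : x ∈ tailSpan A)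
    {B : Matrix (Fin n) (Fin n) ℕ} (hB : coord B x ≠ 0) : LexLT B A := by
  induction hx using AddSubgroup.closure_induction with
  | mem x hx =>
    obtain ⟨f, C, hf, hC, rfl⟩ := hx
    rw [map_smul, coord_Znorm] at hB
    split_ifs at hB with h
    · exact h ▸ hC.lex
    · simp at hB
  | zero => simp at hB
  | add x y _ _ hx hy =>
    by_cases h0 : coord B x = 0
    · exact hy (by simpa [h0] using hB)
    · exact hx h0
  | neg x _ hx => exact hx (by simpa using hB)

end DualCanonical

/-! ### Products over complementary upper and lower sets of positions -/

section Products

variable {n : ℕ}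

theorem list_prod_map_mul {M ι : Type*} [Monoid M] {l : List ι} {f g : ι → M}
    (h : l.Pairwise fun p r => Commute (g p) (f r)) :
    (l.map f).prod * (l.map g).prod = (l.map fun p => f p * g p).prod := by
  induction h with
  | nil => simp
  | @cons p l hp _ ih =>
    have hc : Commute (g p) (l.map f).prod := by
      refine Commute.list_prod_right _ _ fun x hx => ?_
      obtain ⟨r, hr, rfl⟩ := List.mem_map.mp hx
      exact hp r hr
    simp only [List.map_cons, List.prod_cons, ← ih]
    rw [mul_assoc, ← mul_assoc (l.map f).prod, ← hc.eq]
    simp only [mul_assoc]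

/-- The positions in the lexicographic order. -/
def positions (n : ℕ) : List (Fin n × Fin n) :=
  (List.ofFn fun i => List.ofFn fun j => (i, j)).flatten

theorem positions_pairwise (n : ℕ) : (positions n).Pairwise fun p r => toLex p < toLex r := by
  rw [positions, List.pairwise_flatten, List.pairwise_ofFn]
  refine ⟨?_, ?_⟩
  · simp only [List.mem_ofFn, forall_exists_index, forall_apply_eq_imp_iff, List.pairwise_ofFn]
    intro i j k hjk
    exact Prod.Lex.lt_iff.mpr (Or.inr ⟨rfl, hjk⟩)
  · intro i k hik p hp r hr
    obtain ⟨j, rfl⟩ := List.mem_ofFn.mp hp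
    obtain ⟨l, rfl⟩ := List.mem_ofFn.mp hr
    exact Prod.Lex.lt_iff.mpr (Or.inl hik)

theorem Zpow_eq_prod (A : Matrix (Fin n) (Fin n) ℕ) :
    Zpow A = ((positions n).map fun p => Zgen p.1 p.2 ^ A p.1 p.2).prod := by
  rw [positions, List.map_flatten, List.prod_flatten, List.map_ofFn, List.map_ofFn, Zpow]
  congr 2
  funext i
  simp [List.map_ofFn, Function.comp_def]

theorem Zpow_mul_Zpow {U : Set (Fin n × Fin n)} (hU : IsUpperSet U)
    {A B : Matrix (Fin n) (Fin n) ℕ} (hA : SuppIn A Uᶜ) (hB : SuppIn B U) :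
    Zpow A * Zpow B = Zpow (A + B) := by
  simp only [Zpow_eq_prod, Matrix.add_apply, pow_add]
  refine list_prod_map_mul ((positions_pairwise n).imp ?_)
  intro p r hpr
  by_cases hp : B p.1 p.2 = 0
  · simp [hp]
  by_cases hr : A r.1 r.2 = 0
  · simp [hr]
  have hpU := hB _ _ hp
  have hrU := hA _ _ hr
  refine Commute.pow_pow ?_ _ _
  -- The use of the upper set: it leaves only the case in which $r$ is strictly lower and strictly
  -- to the left of $p$, where the generators commute.
  have hle : ¬ (p.1 ≤ r.1 ∧ p.2 ≤ r.2) := fun h => hrU (hU (Prod.mk_le_mk.mpr h) hpU)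
  rcases Prod.Lex.lt_iff.mp hpr with h | ⟨h, h'⟩
  · have h2 : r.2 < p.2 := not_le.mp fun h' => hle ⟨h.le, h'⟩
    exact (Zgen_comm r.1 r.2 p.1 p.2 h h2).symm
  · exact absurd ⟨h.le, h'.le⟩ hle

/-- The exponent of `q` by which a product of normalized monomials over complementary sets of
positions differs from a normalized monomial. -/
def pairing (A B : Matrix (Fin n) (Fin n) ℕ) : ℕ :=
  ∑ i, ro A i * ro B i + ∑ j, co A j * co B j

theorem Znorm_mul_Znorm {U : Set (Fin n × Fin n)} (hU : IsUpperSet U)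
    {A B : Matrix (Fin n) (Fin n) ℕ} (hA : SuppIn A Uᶜ) (hB : SuppIn B U) :
    Znorm A * Znorm B = q ^ (pairing A B : ℤ) • Znorm (A + B) := by
  have h0 : ∑ i, ∑ j, A i j * B i j = 0 := by
    refine Finset.sum_eq_zero fun i _ => Finset.sum_eq_zero fun j _ => ?_
    by_contra h
    exact hA i j (left_ne_zero_of_mul h) (hB i j (right_ne_zero_of_mul h))
  have h := dexp_add A B
  rw [h0, mul_zero, add_zero, ← pairing] at h
  rw [Znorm, Znorm, Znorm, smul_mul_smul_comm, Zpow_mul_Zpow hU hA hB, smul_smul,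
    ← zpow_add₀ q_ne_zero, ← zpow_add₀ q_ne_zero, h]
  congr 2
  push_cast
  ring

theorem tailSpan_mono {A B : Matrix (Fin n) (Fin n) ℕ} (h : Below B A) :
    tailSpan B ≤ tailSpan A :=
  AddSubgroup.closure_mono fun _ ⟨f, C, hf, hC, hx⟩ => ⟨f, C, hf, hC.trans h, hx⟩

theorem evalQ_smul_mem_tailSpan {A : Matrix (Fin n) (Fin n) ℕ} {x : Oq n} (hx : x ∈ tailSpan A)
    (f : ℤ[X]) : evalQ f • x ∈ tailSpan A := by
  induction hx using AddSubgroup.closure_induction with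
  | mem x hx =>
    obtain ⟨g, B, hg, hB, rfl⟩ := hx
    refine AddSubgroup.subset_closure ⟨f * g, B, dvd_mul_of_dvd_right hg f, hB, ?_⟩
    rw [smul_smul, map_mul]
  | zero => rw [smul_zero]; exact zero_mem _
  | add x y _ _ hx hy => rw [smul_add]; exact add_mem hx hy
  | neg x _ hx => rw [smul_neg]; exact neg_mem hx

theorem pairing_congr {A A' B B' : Matrix (Fin n) (Fin n) ℕ} (h₁ : ro A = ro A') (h₂ : co A = co A')
    (h₃ : ro B = ro B') (h₄ : co B = co B') : pairing A B = pairing A' B' := by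
  rw [pairing, pairing, h₁, h₂, h₃, h₄]

theorem Znorm_mul_sub_mem {U : Set (Fin n × Fin n)} (hU : IsUpperSet U)
    {A B : Matrix (Fin n) (Fin n) ℕ} (hA : SuppIn A Uᶜ) (hB : SuppIn B U) {y : Oq n}
    (hy : y - Znorm B ∈ tailSpan B) :
    q ^ (-(pairing A B : ℤ)) • (Znorm A * y) - Znorm (A + B) ∈ tailSpan (A + B) := by
  have hq (k : ℤ) (x : Oq n) : q ^ (-k) • q ^ k • x = x := by
    rw [smul_smul, ← zpow_add₀ q_ne_zero, neg_add_cancel, zpow_zero, one_smul]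
  have key {t : Oq n} (ht : t ∈ tailSpan B) :
      q ^ (-(pairing A B : ℤ)) • (Znorm A * t) ∈ tailSpan (A + B) := by
    induction ht using AddSubgroup.closure_induction with
    | mem x hx =>
      obtain ⟨f, C, hf, hC, rfl⟩ := hx
      refine AddSubgroup.subset_closure ⟨f, A + C, hf, hC.add_left A, ?_⟩
      rw [mul_smul_comm, Znorm_mul_Znorm hU hA (hC.upper U hU hB),
        pairing_congr rfl rfl hC.ro_eq hC.co_eq, smul_comm (evalQ f), hq]
    | zero => rw [mul_zero, smul_zero]; exact zero_mem _
    | add x y _ _ hx hy => rw [mul_add, smul_add]; exact add_mem hx hy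
    | neg x _ hx =>
      have e : Znorm A * -x = -(Znorm A * x) := mul_neg (Znorm A) x
      rw [e, smul_neg]; exact neg_mem hx
  have := key hy
  rwa [mul_sub, smul_sub, Znorm_mul_Znorm hU hA hB, hq] at this

/-- Every term of $x$ stays supported in $U^c$ and every term of $y$ in $U$, with unchanged row and
column sums. So all products of terms carry the same power of $q$, and its removal leaves the
coefficients in $q\mathbb Z[q]$. -/
theorem mul_sub_mem {U : Set (Fin n × Fin n)} (hU : IsUpperSet U)
    {A B : Matrix (Fin n) (Fin n) ℕ} (hA : SuppIn A Uᶜ) (hB : SuppIn B U) {x y : Oq n}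
    (hx : x - Znorm A ∈ tailSpan A) (hy : y - Znorm B ∈ tailSpan B) :
    q ^ (-(pairing A B : ℤ)) • (x * y) - Znorm (A + B) ∈ tailSpan (A + B) := by
  have key {t : Oq n} (ht : t ∈ tailSpan A) :
      q ^ (-(pairing A B : ℤ)) • (t * y) ∈ tailSpan (A + B) := by
    induction ht using AddSubgroup.closure_induction with
    | mem x hx =>
      obtain ⟨f, C, hf, hC, rfl⟩ := hx
      have hb : Below (C + B) (A + B) := by
        rw [add_comm C, add_comm A]; exact hC.add_left B
      have h1 := Znorm_mul_sub_mem hU (hC.lower _ hU.compl hA) hB hy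
      have h2 := evalQ_smul_mem_tailSpan (tailSpan_mono hb h1) f
      have h3 : evalQ f • Znorm (C + B) ∈ tailSpan (A + B) :=
        AddSubgroup.subset_closure ⟨f, _, hf, hb, rfl⟩
      have h4 := add_mem h2 h3
      rw [← smul_add, sub_add_cancel] at h4
      rwa [smul_mul_assoc, smul_comm, ← pairing_congr hC.ro_eq hC.co_eq rfl rfl]
    | zero => rw [zero_mul, smul_zero]; exact zero_mem _
    | add x y _ _ hx hy => rw [add_mul, smul_add]; exact add_mem hx hy
    | neg x _ hx =>
      have e : -x * y = -(x * y) := neg_mul x y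
      rw [e, smul_neg]; exact neg_mem hx
  have h := add_mem (key hx) (Znorm_mul_sub_mem hU hA hB hy)
  rwa [sub_mul, smul_sub, sub_add_sub_cancel] at h

/-- Comparing the coordinates at $A$ of $\bar x$ and $cx$ gives $1=c$. -/
theorem eq_b_of_bar_eq_smul {A : Matrix (Fin n) (Fin n) ℕ} {x : Oq n}
    (hx : x - Znorm A ∈ tailSpan A) {c : K} (hbar : bar x = c • x) : x = b A := by
  have hA (C) : coord C x = (if A = C then 1 else 0) + coord C (x - Znorm A) := by
    rw [map_sub, coord_Znorm]; ring
  have h1 : coord A x = 1 := by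
    have : coord A (x - Znorm A) = 0 := by
      by_contra h0
      exact (coord_tailSpan hx h0).ne rfl
    rw [hA, this]; simp
  have htop (C) (hC : coord C x ≠ 0) : C = A ∨ LexLT C A := by
    by_cases h : A = C
    · exact Or.inl h.symm
    · rw [hA, if_neg h, zero_add] at hC
      exact Or.inr (coord_tailSpan hx hC)
  have h2 := coord_bar_of_top htop
  rw [hbar, map_smul, h1, map_one, smul_eq_mul, mul_one] at h2
  rw [h2, one_smul] at hbar
  exact (isDualCanonical_of_mem hbar hx).eq (isDualCanonical_b A)

/-- The criterion for any splitting of a matrix along an upper set of positions. -/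
theorem equivalent_iff_qCommuting {U : Set (Fin n × Fin n)} (hU : IsUpperSet U)
    {A B : Matrix (Fin n) (Fin n) ℕ} (hA : SuppIn A Uᶜ) (hB : SuppIn B U) :
    Equivalent (b (A + B)) (b B * b A) ↔ QCommuting (b B) (b A) := by
  have hq := q_ne_zero
  constructor
  · rintro ⟨m, hm⟩
    have h := congrArg bar hm
    rw [bar_mul, bar_smul, bar_b, bar_b, bar_b, barK_zpow] at h
    refine ⟨-m - m, ?_⟩
    rw [hm, h, smul_smul, ← zpow_add₀ hq, sub_add_cancel]
  · rintro ⟨m, hm⟩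
    have hx := mul_sub_mem hU hA hB (b_sub_mem A) (b_sub_mem B)
    set N : ℤ := (pairing A B : ℤ)
    have hm' : b B * b A = q ^ (-m) • (b A * b B) := by
      rw [hm, smul_smul, ← zpow_add₀ hq, neg_add_cancel, zpow_zero, one_smul]
    -- For $x=q^{-N}b(A)b(B)$ one has $\bar x=q^Nb(B)b(A)=q^{N-m}b(A)b(B)=q^{2N-m}x$.
    have h := eq_b_of_bar_eq_smul hx (c := q ^ (N - m + N)) <| by
      rw [bar_smul, barK_zpow, neg_neg, bar_mul, bar_b, bar_b, hm', smul_smul, smul_smul,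
        ← zpow_add₀ hq, ← zpow_add₀ hq]
      congr 2
      ring
    refine ⟨N - m, ?_⟩
    rw [hm', ← h, smul_smul, ← zpow_add₀ hq]
    congr 2
    ring

end Products

/-! ### The two sides of a broken line as complementary upper and lower sets -/

namespace BrokenLine

variable {n : ℕ} (ξ : BrokenLine n)

theorem isUpperSet_rightLower :
    IsUpperSet {p : Fin n × Fin n | ξ.RightLower (pt p.1 p.2)} := by
  rintro p r hpr ⟨s, hs, h1, h2⟩
  refine ⟨s, hs, h1.trans ?_, h2.trans ?_⟩
  · have : (p.1 : ℕ) ≤ r.1 := hpr.1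
    simpa [pt] using this
  · have : (p.2 : ℕ) ≤ r.2 := hpr.2
    simpa [pt] using this

theorem suppIn_plusPart (A : Matrix (Fin n) (Fin n) ℕ) :
    SuppIn (ξ.plusPart A) {p | ξ.RightLower (pt p.1 p.2)} := by
  intro i j h
  by_contra h'
  exact h (if_pos h')

theorem suppIn_minusPart (A : Matrix (Fin n) (Fin n) ℕ) :
    SuppIn (ξ.minusPart A) {p | ξ.RightLower (pt p.1 p.2)}ᶜ := by
  intro i j h h'
  exact h (if_neg (not_not.mpr h'))

end BrokenLine

end QMat

end

/-- The first conjunct shows that `b`, introduced through a choice operator, really is the unique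
dual canonical element. -/
theorem theorem4p2 (n : ℕ) :
    (∀ A : Matrix (Fin n) (Fin n) ℕ,
      QMat.IsDualCanonical A (QMat.b A) ∧
        ∀ x : QMat.Oq n, QMat.IsDualCanonical A x → x = QMat.b A) ∧
    ∀ (ξ : QMat.BrokenLine n) (A : Matrix (Fin n) (Fin n) ℕ),
      QMat.Equivalent (QMat.b A) (QMat.b (ξ.plusPart A) * QMat.b (ξ.minusPart A)) ↔
        QMat.QCommuting (QMat.b (ξ.plusPart A)) (QMat.b (ξ.minusPart A)) := by
  refine ⟨fun A => ⟨QMat.isDualCanonical_b A, fun x hx => hx.eq (QMat.isDualCanonical_b A)⟩,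
    fun ξ A => ?_⟩
  have h := QMat.equivalent_iff_qCommuting ξ.isUpperSet_rightLower (ξ.suppIn_minusPart A)
    (ξ.suppIn_plusPart A)
  rwa [add_comm, ξ.plusPart_add_minusPart A] at h
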